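/- **Setting.** Let $\Gamma$ be a metrized graph: a finite connected graph (multiple edges and self-loops allowed) with a finite non-empty vertex set, in which every edge $e_k$ has a length $L_k>0$ and end points $p_k,q_k$, and is parametrized by $[0,L_k]$ with $p_k$ and $q_k$ corresponding to $0$ and $L_k$. We view $\Gamma$ as an electric circuit in which the resistance of a segment is its length. For $x,y,z\in\Gamma$ let $j_z(x,y)$ be the voltage at $x$ when unit current enters at $y$ and exits at $z$, with voltage $0$ at $z$ (that is, $f=j_z(\cdot,y)$ is continuous, affine on every segment of an edge without $y$ or $z$ in its interior, $f(z)=0$, and at every point $a\in\Gamma$ minus the sum of the slopes of $f$ in the directions emanating from $a$ equals $\delta_y(a)-\delta_z(a)$). Let $r(x,y)=j_y(x,x)$ be the effective resistance. Let $\mu_{can}$ be the canonical measure, the signed Borel measure $\mu$ on $\Gamma$ with $\mu(\Gamma)=1$ for which $j_\mu(x,x)=\int_\Gamma j_z(x,x)\,d\mu(z)$ is constant in $x$; let the tau constant $\tau(\Gamma)$ be $\tfrac12 j_{\mu_{can}}(x,x)$; and let, with $\mu=\mu_{can}$, $$g_{\mu_{can}}(x,y)=\int_\Gamma j_z(x,y)\,d\mu(z)-\int_{\Gamma^3}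 j_z(x,y)\,d\mu(z)\,d\mu(x)\,d\mu(y).$$ For an edge $e$, let $\Gamma-e$ be $\Gamma$ with the interior of $e$ deleted; $e$ is a *bridge* if $\Gamma-e$ is disconnected. A point $y$ of $\Gamma-e_i$ is *on the side of* $p_i$ (of $q_i$) if it lies in the connected component of $\Gamma-e_i$ containing $p_i$ (containing $q_i$). A point $a$ is *between* $x$ and $y$ if every path in $\Gamma$ from $x$ to $y$ passes through $a$. **Theorem.** Let $e_i$ and $e_j$ be edges of $\Gamma$, and let $x$ belong to $e_i$ and $y$ to $e_j$; in the formulas $x\in[0,L_i]$ and $y\in[0,L_j]$ also denote the corresponding parameters. 1. If $e_i=e_j$ is a bridge, then $g_{\mu_{can}}(x,y)=\tau(\Gamma)-\frac12|x-y|$. 2. If $e_i$ and $e_j$ are distinct bridges, then at least one of the following four cases occurs, and $$g_{\mu_{can}}(x,y)=\begin{cases} \tau(\Gamma)-\frac12\big(x+y+r(p_i,p_j)\big), & \text{if $p_i$ and $p_j$ are between $x$ and $y$},\\ \tau(\Gamma)-\frac12\big(x+L_j-y+r(p_i,q_j)\big), & \text{if $p_i$ and $q_j$ are between $x$ and $y$},\\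 \tau(\Gamma)-\frac12\big(L_i-x+y+r(p_j,q_i)\big), & \text{if $p_j$ and $q_i$ are between $x$ and $y$},\\ \tau(\Gamma)-\frac12\big(L_i-x+L_j-y+r(q_i,q_j)\big), & \text{if $q_i$ and $q_j$ are between $x$ and $y$}. \end{cases}$$ 3. If $e_i$ is a bridge and $e_j$ is not, then $y$ is on the side of $p_i$ or on the side of $q_i$. If $y$ is on the side of $p_i$, then $$g_{\mu_{can}}(x,y)=\tau(\Gamma)+y^2\,\frac{L_j-r(p_j,q_j)}{2L_j^2}-y\,\frac{L_j-r(p_j,q_j)+r(p_i,q_j)-r(p_i,p_j)}{2L_j}-\frac12\big(x+r(p_i,p_j)\big).$$ If $y$ is on the side of $q_i$, then $$g_{\mu_{can}}(x,y)=\tau(\Gamma)+y^2\,\frac{L_j-r(p_j,q_j)}{2L_j^2}-y\,\frac{L_j-r(p_j,q_j)+r(q_i,q_j)-r(q_i,p_j)}{2L_j}-\frac12\big(L_i-x+r(q_i,p_j)\big).$$ If $e_j$ is a bridge and $e_i$ is not, the same holds with the roles of $(e_i,x)$ and $(e_j,y)$ exchanged. -/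

import Mathlib

/-- A connected metrized graph together with a vertex set `V`, an edge set `E`, and a
parametrization of each edge `e` by `[0, len e]`, the parameter `0` corresponding to `src e` and
`len e` to `tgt e`. Multiple edges and self-loops are allowed. Finiteness of `V` and `E` and
non-emptiness of `V` are imposed by type classes. -/
structure MetrizedGraph (V E : Type*) where
  src : E → V
  tgt : E → V
  len : E → ℝ
  len_pos : ∀ e, 0 < len e
  connected : ∀ u v : V, Relation.EqvGen (fun a b => ∃ e, src e = a ∧ tgt e = b) u v

namespace MetrizedGraph

open MeasureTheory Set

noncomputable section

variable {V E : Type*} (G : MetrizedGraph V E)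

/-- The disjoint union of the vertices and of the closed segments `[0, len e]`. -/
abbrev PrePoint : Type _ := V ⊕ (Σ e : E, Icc (0 : ℝ) (G.len e))

/-- The gluing: the two end points of the segment of `e` are glued to `src e` and `tgt e`. -/
inductive Glue : G.PrePoint → G.PrePoint → Prop
  | src (e : E) : Glue (Sum.inr ⟨e, ⟨0, le_rfl, (G.len_pos e).le⟩⟩) (Sum.inl (G.src e))
  | tgt (e : E) : Glue (Sum.inr ⟨e, ⟨G.len e, (G.len_pos e).le, le_rfl⟩⟩) (Sum.inl (G.tgt e))

/-- The underlying space `Γ` of the metrized graph. -/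
def Point : Type _ := Quot G.Glue

/-- The quotient topology, the vertices being discrete. -/
instance : TopologicalSpace G.Point :=
  letI : TopologicalSpace V := ⊥
  inferInstanceAs (TopologicalSpace (Quot G.Glue))

instance : MeasurableSpace G.Point := borel G.Point

instance : BorelSpace G.Point := ⟨rfl⟩

/-- A vertex, as a point of `Γ`. -/
def vertex (v : V) : G.Point := Quot.mk _ (Sum.inl v)

/-- The point of the edge `e` with parameter `t ∈ [0, len e]` (other reals `t` are clamped to this
interval). -/
def point (e : E) (t : ℝ) : G.Point :=
  Quot.mk _ (Sum.inr ⟨e, projIcc 0 (G.len e) (G.len_pos e).le t⟩)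

/-- The end point of `e` with parameter `0`. -/
def p (e : E) : G.Point := G.vertex (G.src e)

/-- The end point of `e` with parameter `len e`. -/
def q (e : E) : G.Point := G.vertex (G.tgt e)

/-! ### Bridges, sides of an edge, betweenness -/

/-- The interior of the edge `e`. -/
def edgeInterior (e : E) : Set G.Point := G.point e '' Ioo 0 (G.len e)

/-- `Γ - e`: only the interior of `e` is deleted. -/
def deleteEdge (e : E) : Set G.Point := (G.edgeInterior e)ᶜ

/-- `e` is a bridge if `Γ - e` is disconnected. -/
def IsBridge (e : E) : Prop := ¬ IsConnected (G.deleteEdge e)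

/-- `y` is on the side of the point `a` with respect to `e`: it lies in the connected component of
`Γ - e` that contains `a`. -/
def OnSide (e : E) (a y : G.Point) : Prop := y ∈ connectedComponentIn (G.deleteEdge e) a

/-- `a` is between `x` and `y`: every path from `x` to `y` passes through `a`. -/
def Between (a x y : G.Point) : Prop := ∀ γ : Path x y, a ∈ range γ

variable [Fintype E]

/-! ### Voltage and resistance -/

/-- The sum of the slopes of `f` at the point `a` in all directions emanating from `a`: an edge `e`
contributes a forward direction at each parameter `t ∈ [0, len e)` that represents `a`, and a
backward direction at each parameter `t ∈ (0, len e]` that represents `a`. -/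
def slopeSum (f : G.Point → ℝ) (a : G.Point) : ℝ :=
  ∑ e : E,
    ((∑ᶠ (t : ℝ) (_ : t ∈ Ico 0 (G.len e) ∧ G.point e t = a),
        derivWithin (fun s => f (G.point e s)) (Ioi t) t) -
      ∑ᶠ (t : ℝ) (_ : t ∈ Ioc 0 (G.len e) ∧ G.point e t = a),
        derivWithin (fun s => f (G.point e s)) (Iio t) t)

/-- `f` is the voltage on the circuit `Γ` (the resistance of a segment being its length) when unit
current enters at `y` and exits at `z`, with reference voltage `0` at `z`. The current leaving a
point in a given direction is minus the slope of `f` in that direction. -/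
structure IsVoltage (z y : G.Point) (f : G.Point → ℝ) : Prop where
  /-- Ohm's law: `f` is affine on every segment of an edge without a terminal in its interior.
  (This includes the continuity of `f`.) -/
  affine : ∀ (e : E) (a b : ℝ), 0 ≤ a → a ≤ b → b ≤ G.len e →
    (∀ t ∈ Ioo a b, G.point e t ≠ y ∧ G.point e t ≠ z) →
    ∃ m c : ℝ, ∀ t ∈ Icc a b, f (G.point e t) = m * t + c
  /-- Kirchhoff's law: `Δ f = δ_y - δ_z`. -/
  kirchhoff : ∀ a : G.Point,
    -G.slopeSum f a = indicator {y} (fun _ => (1 : ℝ)) a - indicator {z} (fun _ => (1 : ℝ)) a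
  ground : f z = 0

/-- The voltage function `j_z(x, y)`: the value at `x` of the voltage for unit current entering at
`y` and exiting at `z`, grounded at `z`. -/
def voltage (z x y : G.Point) : ℝ := Classical.epsilon (G.IsVoltage z y) x

/-- The effective resistance `r(x, y) = j_y(x, x)`. -/
def resistance (x y : G.Point) : ℝ := G.voltage y x x

/-! ### Canonical measure, tau constant, Arakelov-Green function -/

/-- `j_μ(x, y) = ∫ j_z(x, y) dμ(z)`. -/
def voltageIntegral (μ : SignedMeasure G.Point) (x y : G.Point) : ℝ :=
  ∫ᵛ z, G.voltage z x y ∂•μ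

/-- `μ` has total mass `1`, and `j_μ(x, x)` is constant on `Γ`. -/
def IsCanonicalMeasure (μ : SignedMeasure G.Point) : Prop :=
  μ univ = 1 ∧ ∃ c : ℝ, ∀ x, G.voltageIntegral μ x x = c

/-- The canonical measure `μ_can`. -/
def canonicalMeasure : SignedMeasure G.Point := Classical.epsilon G.IsCanonicalMeasure

/-- The tau constant: half of the constant `j_μ(x, x)` for `μ = μ_can`, read off at some vertex. -/
def tau [Nonempty V] : ℝ :=
  (1 / 2) * G.voltageIntegral G.canonicalMeasure
    (G.vertex (Classical.arbitrary V)) (G.vertex (Classical.arbitrary V))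

/-- The Arakelov-Green function `g_μ(x, y)` of a signed Borel measure `μ`. -/
def arakelovGreen (μ : SignedMeasure G.Point) (x y : G.Point) : ℝ :=
  (∫ᵛ z, G.voltage z x y ∂•μ) - ∫ᵛ y', (∫ᵛ x', (∫ᵛ z, G.voltage z x' y' ∂•μ) ∂•μ) ∂•μ

/-- The Arakelov-Green function `g_{μ_can}(x, y)`. -/
def greenCan (x y : G.Point) : ℝ := G.arakelovGreen G.canonicalMeasure x y

end

end MetrizedGraph

/-!
Inverting the vertex Laplacian, interpolating along the edges and adding the Dirichlet Green
functions of the edges gives a symmetric kernel `K` on `Γ` such that the Laplacian of `K(·, y)` is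
`δ_y - ν`, where `ν` is the uniform probability measure on the vertices, whatever `y` is. Hence
`j_z(x, y) = K(x, y) - K(x, z) - K(y, z) + K(z, z)` and `r(x, y) = K(x, x) - 2 K(x, y) + K(y, y)`.

An explicit signed measure `μ` of mass `1` for which `∫ K(z, x) dμ(z) - K(x, x) / 2` is constant
in `x` shows that the canonical measure exists. Since
`2 j_μ(x, y) = j_μ(x, x) + j_μ(y, y) - r(x, y)` for every measure `μ` of mass `1`, it follows that
`g_{μ_can} = τ(Γ) - r / 2`, and it remains to compute `r`.

For a bridge `i`, the indicator function of the side of `p_i`, extended affinely to `i`, is the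
voltage of a dipole at the end points of `i`. This makes `K(p_i, y) - K(q_i, y)` explicit, and `r`
additive across a point of `i`. From a point outside the interior of an edge, `r` is quadratic in
the parameter of the edge.
-/

namespace MetrizedGraph

open Filter Matrix MeasureTheory Set Topology

noncomputable section

variable {V E : Type*} (G : MetrizedGraph V E)

/-! ### Points of a metrized graph -/

lemma point_zero (e : E) : G.point e 0 = G.p e := by
  rw [point, projIcc_left]
  exact Quot.sound (Glue.src e)

lemma point_len (e : E) : G.point e (G.len e) = G.q e := by
  rw [point, projIcc_right]
  exact Quot.sound (Glue.tgt e)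

lemma len_mem_Icc (e : E) : G.len e ∈ Icc 0 (G.len e) := right_mem_Icc.2 (G.len_pos e).le

lemma zero_mem_Icc (e : E) : (0 : ℝ) ∈ Icc 0 (G.len e) := left_mem_Icc.2 (G.len_pos e).le

lemma mem_Icc_of_eq_zero_or_len {e : E} {t : ℝ} (ht : t = 0 ∨ t = G.len e) :
    t ∈ Icc 0 (G.len e) := by
  obtain rfl | rfl := ht
  exacts [G.zero_mem_Icc e, G.len_mem_Icc e]

lemma mk_inr (e : E) (t : Icc (0 : ℝ) (G.len e)) :
    (Quot.mk _ (Sum.inr ⟨e, t⟩) : G.Point) = G.point e t := by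
  rw [point, projIcc_val]

lemma exists_vertex_or_point (a : G.Point) :
    (∃ v, a = G.vertex v) ∨ ∃ e, ∃ t ∈ Ioo 0 (G.len e), a = G.point e t := by
  obtain ⟨v | ⟨e, t⟩, rfl⟩ := Quot.exists_rep a
  · exact Or.inl ⟨v, rfl⟩
  · rw [mk_inr]
    rcases t.2.1.eq_or_lt with h0 | h0
    · exact Or.inl ⟨G.src e, by rw [← h0, point_zero, p]⟩
    rcases t.2.2.eq_or_lt with h1 | h1
    · exact Or.inl ⟨G.tgt e, by rw [h1, point_len, q]⟩
    · exact Or.inr ⟨e, t, ⟨h0, h1⟩, rfl⟩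

lemma continuous_point (e : E) : Continuous (G.point e) := by
  let _ : TopologicalSpace V := ⊥
  exact continuous_quot_mk.comp
    (continuous_inr.comp (continuous_sigmaMk.comp continuous_projIcc) :
      Continuous fun t => (Sum.inr ⟨e, projIcc 0 (G.len e) (G.len_pos e).le t⟩ : G.PrePoint))

lemma continuous_of_point {X : Type*} [TopologicalSpace X] {f : G.Point → X}
    (hf : ∀ e, ContinuousOn (fun t => f (G.point e t)) (Icc 0 (G.len e))) : Continuous f := by
  let _ : TopologicalSpace V := ⊥
  have : DiscreteTopology V := ⟨rfl⟩
  refine continuous_coinduced_dom.2 <| continuous_sum_dom.2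
    ⟨continuous_of_discreteTopology, continuous_sigma fun e => ?_⟩
  refine (continuousOn_iff_continuous_domRestrict.1 (hf e)).congr fun t => ?_
  exact congrArg f (G.mk_inr e t).symm

lemma isClosed_of_point {C : Set G.Point}
    (hC : ∀ e, IsClosed (Icc 0 (G.len e) ∩ G.point e ⁻¹' C)) : IsClosed C := by
  let _ : TopologicalSpace V := ⊥
  have : DiscreteTopology V := ⟨rfl⟩
  refine isClosed_coinduced.2 <| isClosed_sum_iff.2
    ⟨isClosed_discrete _, isClosed_sigma_iff.2 fun e => ?_⟩
  convert (hC e).preimage continuous_subtype_val using 1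
  ext t
  refine Iff.trans ?_ (and_iff_right t.2).symm
  exact iff_of_eq (congrArg (· ∈ C) (G.mk_inr e t))

instance [Finite V] [Finite E] : CompactSpace G.Point := by
  let _ : TopologicalSpace V := ⊥
  exact inferInstanceAs (CompactSpace (Quot G.Glue))

section interpolate

variable {M : Type*} [AddCommGroup M] [Module ℝ M]

/-- The piecewise affine extension to `Γ` of a function on the vertices. -/
def interpolate (u : V → M) : G.Point → M :=
  Quot.lift (Sum.elim u fun t =>
    (1 - (t.2 : ℝ) / G.len t.1) • u (G.src t.1) + ((t.2 : ℝ) / G.len t.1) • u (G.tgt t.1)) <| by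
    rintro _ _ (e | e)
    · simp
    · simp [(G.len_pos e).ne']

lemma interpolate_vertex (u : V → M) (v : V) : G.interpolate u (G.vertex v) = u v := rfl

lemma interpolate_point (u : V → M) {e : E} {t : ℝ} (ht : t ∈ Icc 0 (G.len e)) :
    G.interpolate u (G.point e t) =
      (1 - t / G.len e) • u (G.src e) + (t / G.len e) • u (G.tgt e) := by
  rw [point, projIcc_of_mem _ ht]; rfl

lemma map_interpolate {N : Type*} [AddCommGroup N] [Module ℝ N] (φ : M →ₗ[ℝ] N) (u : V → M)
    (x : G.Point) : φ (G.interpolate u x) = G.interpolate (fun v => φ (u v)) x := by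
  obtain ⟨v, rfl⟩ | ⟨e, t, ht, rfl⟩ := G.exists_vertex_or_point x
  · rfl
  · simp only [G.interpolate_point _ (Ioo_subset_Icc_self ht), map_add, map_smul]

lemma interpolate_const (u : M) (x : G.Point) : G.interpolate (fun _ => u) x = u := by
  obtain ⟨v, rfl⟩ | ⟨e, t, ht, rfl⟩ := G.exists_vertex_or_point x
  · rfl
  · rw [G.interpolate_point _ (Ioo_subset_Icc_self ht), ← add_smul, sub_add_cancel, one_smul]

lemma continuous_interpolate (u : V → ℝ) : Continuous (G.interpolate u) :=
  G.continuous_of_point fun e =>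
    (by fun_prop : Continuous fun t : ℝ => (1 - t / G.len e) • u (G.src e) +
      (t / G.len e) • u (G.tgt e)).continuousOn.congr fun _ ht => G.interpolate_point u ht

end interpolate

lemma vertex_injective : Function.Injective G.vertex := by
  classical
  intro v w h
  have h := congrArg (G.interpolate (Pi.single v (1 : ℝ))) h
  by_contra hne
  simp [interpolate_vertex, Ne.symm hne] at h

open Classical in
/-- The parameter of a point of the interior of `e`, and `0` outside of the interior of `e` (also
at the end point `q e`, whose parameter is `len e`). -/
def coord (e : E) : G.Point → ℝ :=
  Quot.lift (Sum.elim (fun _ => 0) fun t =>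
    if t.1 = e ∧ (t.2 : ℝ) < G.len t.1 then (t.2 : ℝ) else 0) <| by
    rintro _ _ (e' | e') <;> simp

section coord

lemma coord_vertex (e : E) (v : V) : G.coord e (G.vertex v) = 0 := rfl

lemma coord_point_self {e : E} {t : ℝ} (ht : t ∈ Ico 0 (G.len e)) :
    G.coord e (G.point e t) = t := by
  rw [point, projIcc_of_mem _ ⟨ht.1, ht.2.le⟩]
  simp [coord, ht.2]

lemma coord_point_of_ne {e e' : E} (h : e' ≠ e) (t : ℝ) : G.coord e (G.point e' t) = 0 := by
  simp [coord, point, h]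

lemma coord_mem_Ico (e : E) (a : G.Point) : G.coord e a ∈ Ico 0 (G.len e) := by
  have h0 : (0 : ℝ) ∈ Ico 0 (G.len e) := left_mem_Ico.2 (G.len_pos e)
  obtain ⟨v, rfl⟩ | ⟨e', t, ht, rfl⟩ := G.exists_vertex_or_point a
  · exact h0
  · obtain rfl | h := eq_or_ne e' e
    · rw [G.coord_point_self (Ioo_subset_Ico_self ht)]
      exact Ioo_subset_Ico_self ht
    · rwa [G.coord_point_of_ne h]

lemma point_eq_iff_coord {e : E} {t : ℝ} (ht : t ∈ Ioo 0 (G.len e)) (a : G.Point) :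
    G.point e t = a ↔ G.coord e a = t := by
  refine ⟨?_, fun h => ?_⟩
  · rintro rfl
    exact G.coord_point_self (Ioo_subset_Ico_self ht)
  obtain ⟨v, rfl⟩ | ⟨e', t', ht', rfl⟩ := G.exists_vertex_or_point a
  · exact absurd h ht.1.ne
  · obtain rfl | he := eq_or_ne e' e
    · rw [← h, G.coord_point_self (Ioo_subset_Ico_self ht')]
    · rw [G.coord_point_of_ne he] at h
      exact absurd h ht.1.ne

lemma point_ne_vertex {e : E} {t : ℝ} (ht : t ∈ Ioo 0 (G.len e)) (v : V) :
    G.point e t ≠ G.vertex v := by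
  rw [Ne, G.point_eq_iff_coord ht, coord_vertex]
  exact ht.1.ne

lemma edge_eq_of_point_eq {e e' : E} {t t' : ℝ} (ht : t ∈ Ioo 0 (G.len e))
    (h : G.point e' t' = G.point e t) : e' = e := by
  by_contra hne
  have := (G.point_eq_iff_coord ht _).1 h.symm
  rw [G.coord_point_of_ne hne] at this
  exact ht.1.ne this

lemma mem_deleteEdge_iff_coord {e : E} {a : G.Point} :
    a ∈ G.deleteEdge e ↔ G.coord e a = 0 := by
  rw [deleteEdge, edgeInterior, mem_compl_iff, not_iff_comm]
  refine ⟨fun h => ?_, ?_⟩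
  · have hcoord := G.coord_mem_Ico e a
    have ht : G.coord e a ∈ Ioo 0 (G.len e) := ⟨hcoord.1.lt_of_ne' h, hcoord.2⟩
    exact ⟨_, ht, (G.point_eq_iff_coord ht a).2 rfl⟩
  · rintro ⟨t, ht, rfl⟩
    rw [G.coord_point_self (Ioo_subset_Ico_self ht)]
    exact ht.1.ne'

end coord

/-! ### The vertex Laplacian -/

open Classical in
/-- The signed incidence vector of an edge. -/
def incidence (e : E) : V → ℝ := Pi.single (G.src e) 1 - Pi.single (G.tgt e) 1

/-- The vertex Laplacian, the conductance of an edge being the inverse of its length. -/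
def laplacian [Fintype E] : (V → ℝ) →ₗ[ℝ] V → ℝ where
  toFun u := ∑ e, ((u (G.src e) - u (G.tgt e)) / G.len e) • G.incidence e
  map_add' u w := by
    rw [← Finset.sum_add_distrib]
    refine Finset.sum_congr rfl fun e _ => ?_
    rw [← add_smul, ← add_div, Pi.add_apply, Pi.add_apply, add_sub_add_comm]
  map_smul' c u := by
    rw [RingHom.id_apply, Finset.smul_sum]
    refine Finset.sum_congr rfl fun e _ => ?_
    rw [smul_smul, Pi.smul_apply, Pi.smul_apply, ← smul_sub, smul_eq_mul, mul_div_assoc]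

lemma laplacian_apply [Fintype E] (u : V → ℝ) :
    G.laplacian u = ∑ e, ((u (G.src e) - u (G.tgt e)) / G.len e) • G.incidence e := rfl

lemma laplacian_const [Fintype E] (c : ℝ) : G.laplacian (fun _ => c) = 0 := by
  simp [laplacian_apply]

lemma eq_of_forall_edge {α : Type*} {u : V → α} (h : ∀ e, u (G.src e) = u (G.tgt e)) (v w : V) :
    u v = u w := by
  induction G.connected v w with
  | rel a b hab => obtain ⟨e, rfl, rfl⟩ := hab; exact h e
  | refl => rfl
  | symm _ _ _ ih => exact ih.symm
  | trans _ _ _ _ _ ih₁ ih₂ => exact ih₁.trans ih₂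

section laplacian

variable [Fintype V]

lemma dotProduct_incidence (u : V → ℝ) (e : E) :
    u ⬝ᵥ G.incidence e = u (G.src e) - u (G.tgt e) := by
  simp [incidence, dotProduct_sub]

variable [Fintype E]

lemma dotProduct_laplacian (u w : V → ℝ) :
    w ⬝ᵥ G.laplacian u =
      ∑ e, (u (G.src e) - u (G.tgt e)) / G.len e * (w (G.src e) - w (G.tgt e)) := by
  simp only [laplacian_apply, dotProduct_sum, dotProduct_smul, dotProduct_incidence, smul_eq_mul]

lemma dotProduct_laplacian_comm (u w : V → ℝ) : w ⬝ᵥ G.laplacian u = u ⬝ᵥ G.laplacian w := by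
  rw [dotProduct_laplacian, dotProduct_laplacian]
  exact Finset.sum_congr rfl fun e _ => by ring

lemma sum_laplacian (u : V → ℝ) : ∑ v, G.laplacian u v = 0 := by
  simpa [dotProduct] using G.dotProduct_laplacian u (fun _ => 1)

end laplacian

lemma eq_of_laplacian_eq_zero [Finite V] [Fintype E] {u : V → ℝ} (h : G.laplacian u = 0) (v w : V) :
    u v = u w := by
  have := Fintype.ofFinite V
  have energy := G.dotProduct_laplacian u u
  rw [h, dotProduct_zero, eq_comm, Finset.sum_eq_zero_iff_of_nonneg fun e _ => by
    rw [div_mul_eq_mul_div]; exact div_nonneg (mul_self_nonneg _) (G.len_pos e).le] at energy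
  refine G.eq_of_forall_edge (fun e => ?_) v w
  simpa [(G.len_pos e).ne', sub_eq_zero] using energy e (Finset.mem_univ e)

section potential

variable [Fintype V] [Fintype E]

/-- The vertex Laplacian, made invertible by adding the all-ones matrix. -/
def laplacianAddSum : (V → ℝ) →ₗ[ℝ] V → ℝ :=
  G.laplacian + (∑ v, LinearMap.proj v : (V → ℝ) →ₗ[ℝ] ℝ).smulRight (fun _ => 1)

lemma laplacianAddSum_apply (u : V → ℝ) (v : V) :
    G.laplacianAddSum u v = G.laplacian u v + ∑ w, u w := by
  simp [laplacianAddSum]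

lemma dotProduct_laplacianAddSum_comm (u w : V → ℝ) :
    w ⬝ᵥ G.laplacianAddSum u = u ⬝ᵥ G.laplacianAddSum w := by
  have h (u w : V → ℝ) : w ⬝ᵥ G.laplacianAddSum u = w ⬝ᵥ G.laplacian u + (∑ v, w v) * ∑ v, u v := by
    simp [dotProduct, laplacianAddSum_apply, mul_add, Finset.sum_add_distrib, Finset.sum_mul]
  rw [h, h, dotProduct_laplacian_comm, mul_comm (∑ v, w v)]

lemma sum_laplacianAddSum (u : V → ℝ) :
    ∑ v, G.laplacianAddSum u v = Fintype.card V * ∑ w, u w := by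
  simp [laplacianAddSum_apply, Finset.sum_add_distrib, sum_laplacian]

lemma laplacianAddSum_injective : Function.Injective G.laplacianAddSum := by
  refine (injective_iff_map_eq_zero _).2 fun u hu => funext fun v => ?_
  have hcard : (Fintype.card V : ℝ) ≠ 0 := Nat.cast_ne_zero.2 (Fintype.card_pos_iff.2 ⟨v⟩).ne'
  have hsum : ∑ w, u w = 0 := by simpa [hu, hcard] using G.sum_laplacianAddSum u
  have hlap : G.laplacian u = 0 := funext fun w => by
    simpa [hu, hsum] using (G.laplacianAddSum_apply u w).symm
  simpa [G.eq_of_laplacian_eq_zero hlap _ v, hcard] using hsum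

/-- The inverse of the Laplacian on vectors of sum `0`, extended to all vectors so as to be
invertible and symmetric. -/
def potential : (V → ℝ) ≃ₗ[ℝ] V → ℝ :=
  (LinearEquiv.ofInjectiveEndo _ G.laplacianAddSum_injective).symm

lemma laplacianAddSum_potential (b : V → ℝ) : G.laplacianAddSum (G.potential b) = b :=
  (LinearEquiv.ofInjectiveEndo _ G.laplacianAddSum_injective).apply_symm_apply b

lemma potential_laplacianAddSum (u : V → ℝ) : G.potential (G.laplacianAddSum u) = u :=
  (LinearEquiv.ofInjectiveEndo _ G.laplacianAddSum_injective).symm_apply_apply u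

lemma dotProduct_potential_comm (b c : V → ℝ) :
    b ⬝ᵥ G.potential c = c ⬝ᵥ G.potential b := by
  have h := G.dotProduct_laplacianAddSum_comm (G.potential b) (G.potential c)
  rw [laplacianAddSum_potential, laplacianAddSum_potential] at h
  rw [dotProduct_comm, h, dotProduct_comm]

lemma laplacian_potential (b : V → ℝ) (v : V) :
    G.laplacian (G.potential b) v = b v - (∑ w, b w) / Fintype.card V := by
  have hcard : (Fintype.card V : ℝ) ≠ 0 := Nat.cast_ne_zero.2 (Fintype.card_pos_iff.2 ⟨v⟩).ne'
  have hsum := G.sum_laplacianAddSum (G.potential b)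
  have h := G.laplacianAddSum_apply (G.potential b) v
  rw [laplacianAddSum_potential] at h hsum
  rw [hsum, mul_div_cancel_left₀ _ hcard, h, add_sub_cancel_right]

lemma potential_const (c : ℝ) (v : V) : G.potential (fun _ => c) v = c / Fintype.card V := by
  have hcard : (Fintype.card V : ℝ) ≠ 0 := Nat.cast_ne_zero.2 (Fintype.card_pos_iff.2 ⟨v⟩).ne'
  have h : G.laplacianAddSum (fun _ => c / Fintype.card V) = fun _ => c := funext fun w => by
    simp [laplacianAddSum_apply, laplacian_const, mul_div_cancel₀ _ hcard]
  rw [← h, potential_laplacianAddSum]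

lemma potential_laplacian (u : V → ℝ) (v : V) :
    G.potential (G.laplacian u) v = u v - (∑ w, u w) / Fintype.card V := by
  have h : G.laplacian u = G.laplacianAddSum u - fun _ => ∑ w, u w := funext fun w => by
    simp [laplacianAddSum_apply]
  rw [h, map_sub, Pi.sub_apply, potential_laplacianAddSum, potential_const]

end potential

/-! ### The kernel -/

/-- The Green function of the segment `[0, len e]` with Dirichlet boundary conditions. -/
def hat (e : E) (s t : ℝ) : ℝ := min s t - s * t / G.len e

lemma hat_comm (e : E) (s t : ℝ) : G.hat e s t = G.hat e t s := by
  simp [hat, min_comm, mul_comm]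

lemma hat_zero_left (e : E) {t : ℝ} (ht : 0 ≤ t) : G.hat e 0 t = 0 := by simp [hat, ht]

lemma hat_len_left (e : E) {t : ℝ} (ht : t ≤ G.len e) : G.hat e (G.len e) t = 0 := by
  simp [hat, ht, (G.len_pos e).ne']

lemma hat_coord_vertex (e : E) (v : V) {t : ℝ} (ht : 0 ≤ t) :
    G.hat e (G.coord e (G.vertex v)) t = 0 := by
  rw [coord_vertex, hat_zero_left G e ht]

lemma hat_coord_point_of_ne {e e' : E} (h : e' ≠ e) (s : ℝ) {t : ℝ} (ht : 0 ≤ t) :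
    G.hat e (G.coord e (G.point e' s)) t = 0 := by
  rw [G.coord_point_of_ne h, hat_zero_left G e ht]

lemma hat_coord_point {e : E} {s t : ℝ} (hs : s ∈ Icc 0 (G.len e)) (ht : t ∈ Icc 0 (G.len e)) :
    G.hat e (G.coord e (G.point e s)) t = G.hat e s t := by
  obtain rfl | h := hs.2.eq_or_lt
  · rw [point_len, q, hat_coord_vertex G e _ ht.1, hat_len_left G e ht.2]
  · rw [G.coord_point_self ⟨hs.1, h⟩]

lemma continuous_hat_coord {e : E} {t : ℝ} (ht : t ∈ Icc 0 (G.len e)) :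
    Continuous fun x => G.hat e (G.coord e x) t := by
  refine G.continuous_of_point fun e' => ?_
  obtain rfl | he := eq_or_ne e' e
  · refine ContinuousOn.congr ?_ fun s hs => G.hat_coord_point hs ht
    unfold hat
    fun_prop
  · simpa only [G.hat_coord_point_of_ne he _ ht.1] using continuousOn_const

lemma hat_coord_point_self {e : E} {t : ℝ} (ht : t ∈ Icc 0 (G.len e)) :
    G.hat e (G.coord e (G.point e t)) (G.coord e (G.point e t)) = G.hat e t t := by
  rw [G.hat_coord_point ht (Ico_subset_Icc_self (G.coord_mem_Ico e _)), hat_comm,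
    G.hat_coord_point ht ht]

lemma continuous_hat_coord_self (e : E) :
    Continuous fun x => G.hat e (G.coord e x) (G.coord e x) := by
  refine G.continuous_of_point fun e' => ?_
  obtain rfl | he := eq_or_ne e' e
  · refine ContinuousOn.congr ?_ fun s hs => G.hat_coord_point_self hs
    unfold hat
    fun_prop
  · simpa only [G.coord_point_of_ne he] using continuousOn_const

/-- The barycentric weights of a point: the unit mass at a point of an edge, distributed linearly to
the end points of the edge. -/
def weight (x : G.Point) : V → ℝ :=
  open Classical in G.interpolate (fun v => Pi.single v 1) x

section kernel

variable [Fintype V]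

lemma weight_dotProduct (x : G.Point) (u : V → ℝ) : G.weight x ⬝ᵥ u = G.interpolate u x := by
  classical
  rw [dotProduct_comm, weight]
  refine (G.map_interpolate (dotProductBilin ℝ ℝ u) _ x).trans ?_
  simp

lemma sum_weight (x : G.Point) : ∑ v, G.weight x v = 1 := by
  have h := G.weight_dotProduct x (fun _ => 1)
  obtain ⟨v, rfl⟩ | ⟨e, t, ht, rfl⟩ := G.exists_vertex_or_point x
  · simpa [dotProduct, interpolate_vertex] using h
  · simpa [dotProduct, G.interpolate_point _ (Ioo_subset_Icc_self ht)] using h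

variable [Fintype E]

/-- A symmetric kernel on `Γ` from which all voltage functions are computed. -/
def kernel (x y : G.Point) : ℝ :=
  G.weight x ⬝ᵥ G.potential (G.weight y) + ∑ e, G.hat e (G.coord e x) (G.coord e y)

lemma kernel_comm (x y : G.Point) : G.kernel x y = G.kernel y x := by
  rw [kernel, kernel, dotProduct_potential_comm]
  simp only [hat_comm]

lemma kernel_vertex (v : V) (y : G.Point) :
    G.kernel (G.vertex v) y = G.potential (G.weight y) v := by
  rw [kernel, weight_dotProduct, interpolate_vertex, Finset.sum_eq_zero, add_zero]
  exact fun e _ => G.hat_coord_vertex e v (G.coord_mem_Ico e y).1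

lemma kernel_vertex_right (x : G.Point) (w : V) :
    G.kernel x (G.vertex w) = G.interpolate (G.potential (G.weight (G.vertex w))) x := by
  rw [kernel, weight_dotProduct, Finset.sum_eq_zero, add_zero]
  exact fun e _ => by rw [hat_comm, G.hat_coord_vertex e w (G.coord_mem_Ico e x).1]

lemma kernel_point_right (x : G.Point) {e : E} {s : ℝ} (hs : s ∈ Icc 0 (G.len e)) :
    G.kernel x (G.point e s) =
      G.interpolate (G.potential (G.weight (G.point e s))) x + G.hat e (G.coord e x) s := by
  rw [kernel, weight_dotProduct, Finset.sum_eq_single e, hat_comm,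
    G.hat_coord_point hs (Ico_subset_Icc_self (G.coord_mem_Ico e x)), hat_comm]
  · exact fun e' _ he => by
      rw [hat_comm, G.hat_coord_point_of_ne he.symm _ (G.coord_mem_Ico e' x).1]
  · simp

lemma kernel_eq_interpolate (x y : G.Point) :
    G.kernel x y = G.interpolate (fun v => G.kernel (G.vertex v) y) x +
      ∑ e, G.hat e (G.coord e x) (G.coord e y) := by
  simp only [kernel_vertex]
  rw [kernel, weight_dotProduct]

lemma kernel_point {e : E} {t : ℝ} (ht : t ∈ Icc 0 (G.len e)) (y : G.Point) :
    G.kernel (G.point e t) y = (1 - t / G.len e) * G.kernel (G.p e) y +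
      t / G.len e * G.kernel (G.q e) y + G.hat e t (G.coord e y) := by
  have hy := Ico_subset_Icc_self (G.coord_mem_Ico e y)
  rw [kernel_eq_interpolate, G.interpolate_point _ ht, Finset.sum_eq_single e,
    G.hat_coord_point ht hy]
  · rfl
  · exact fun e' _ he => G.hat_coord_point_of_ne he.symm _ (G.coord_mem_Ico e' y).1
  · simp

lemma kernel_point_self {e : E} {t : ℝ} (ht : t ∈ Icc 0 (G.len e)) :
    G.kernel (G.point e t) (G.point e t) =
      (1 - t / G.len e) * G.kernel (G.p e) (G.p e) + t / G.len e * G.kernel (G.q e) (G.q e) +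
        (1 - (G.kernel (G.p e) (G.p e) - 2 * G.kernel (G.p e) (G.q e) +
          G.kernel (G.q e) (G.q e)) / G.len e) * G.hat e t t := by
  have hvertex (v : V) : G.hat e t (G.coord e (G.vertex v)) = 0 := by
    rw [hat_comm, G.hat_coord_vertex e v ht.1]
  have hL := (G.len_pos e).ne'
  rw [G.kernel_point ht, G.kernel_comm (G.p e) (G.point e t), G.kernel_comm (G.q e) (G.point e t),
    G.kernel_point ht, G.kernel_point ht, G.kernel_comm (G.q e) (G.p e), p, q, hvertex, hvertex,
    hat_comm, G.hat_coord_point ht ht, hat, min_self]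
  field_simp
  ring

lemma kernel_self (x : G.Point) :
    G.kernel x x = G.interpolate (fun v => G.kernel (G.vertex v) (G.vertex v)) x +
      ∑ e, (1 - (G.kernel (G.p e) (G.p e) - 2 * G.kernel (G.p e) (G.q e) +
        G.kernel (G.q e) (G.q e)) / G.len e) * G.hat e (G.coord e x) (G.coord e x) := by
  obtain ⟨v, rfl⟩ | ⟨e, t, ht, rfl⟩ := G.exists_vertex_or_point x
  · rw [interpolate_vertex, Finset.sum_eq_zero, add_zero]
    intro e _
    rw [G.hat_coord_vertex e v (G.coord_mem_Ico e _).1, mul_zero]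
  · have ht' := Ioo_subset_Icc_self ht
    rw [Finset.sum_eq_single e, G.interpolate_point _ ht', G.kernel_point_self ht',
      G.hat_coord_point_self ht']
    · rfl
    · intro e' _ he
      rw [G.hat_coord_point_of_ne he.symm _ (G.coord_mem_Ico e' _).1, mul_zero]
    · simp

lemma continuous_kernel (y : G.Point) : Continuous fun x => G.kernel x y :=
  ((G.continuous_interpolate _).add <| continuous_finsetSum _ fun e _ =>
    G.continuous_hat_coord (Ico_subset_Icc_self (G.coord_mem_Ico e y))).congr fun x =>
      (G.kernel_eq_interpolate x y).symm

lemma continuous_kernel_self : Continuous fun x => G.kernel x x :=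
  ((G.continuous_interpolate _).add <| continuous_finsetSum _ fun e _ =>
    continuous_const.mul (G.continuous_hat_coord_self e)).congr fun x => (G.kernel_self x).symm

end kernel

/-! ### Piecewise affine functions -/

section IsAffineOn

/-- `φ` is affine on the interval `[a, b]`. -/
def IsAffineOn (φ : ℝ → ℝ) (a b : ℝ) : Prop := ∃ m c : ℝ, ∀ t ∈ Icc a b, φ t = m * t + c

variable {φ : ℝ → ℝ} {a b m c t : ℝ}

lemma hasDerivWithinAt_Ioi_of_affine (htb : t < b) (h : ∀ s ∈ Icc t b, φ s = m * s + c) :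
    HasDerivWithinAt φ m (Ioi t) t := by
  have hlin : HasDerivWithinAt (fun s => m * s + c) m (Ioi t) t := by
    simpa using (((hasDerivAt_id t).const_mul m).add_const c).hasDerivWithinAt (s := Ioi t)
  refine hlin.congr_of_eventuallyEq ?_ (h t ⟨le_rfl, htb.le⟩)
  filter_upwards [Ioc_mem_nhdsGT htb] with s hs using h s (Ioc_subset_Icc_self hs)

lemma hasDerivWithinAt_Iio_of_affine (hat : a < t) (h : ∀ s ∈ Icc a t, φ s = m * s + c) :
    HasDerivWithinAt φ m (Iio t) t := by
  have hlin : HasDerivWithinAt (fun s => m * s + c) m (Iio t) t := by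
    simpa using (((hasDerivAt_id t).const_mul m).add_const c).hasDerivWithinAt (s := Iio t)
  refine hlin.congr_of_eventuallyEq ?_ (h t ⟨hat.le, le_rfl⟩)
  filter_upwards [Ico_mem_nhdsLT hat] with s hs using h s (Ico_subset_Icc_self hs)

lemma derivWithin_Ioi_of_affine (htb : t < b) (h : ∀ s ∈ Icc t b, φ s = m * s + c) :
    derivWithin φ (Ioi t) t = m :=
  (hasDerivWithinAt_Ioi_of_affine htb h).derivWithin (uniqueDiffWithinAt_Ioi t)

lemma derivWithin_Iio_of_affine (hat : a < t) (h : ∀ s ∈ Icc a t, φ s = m * s + c) :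
    derivWithin φ (Iio t) t = m :=
  (hasDerivWithinAt_Iio_of_affine hat h).derivWithin (uniqueDiffWithinAt_Iio t)

lemma IsAffineOn.union (h₁ : IsAffineOn φ a t) (h₂ : IsAffineOn φ t b) (hat : a < t) (htb : t < b)
    (h : derivWithin φ (Ioi t) t = derivWithin φ (Iio t) t) : IsAffineOn φ a b := by
  obtain ⟨m₁, c₁, h₁⟩ := h₁
  obtain ⟨m₂, c₂, h₂⟩ := h₂
  rw [derivWithin_Ioi_of_affine htb h₂, derivWithin_Iio_of_affine hat h₁] at h
  have hc : m₁ * t + c₁ = m₂ * t + c₂ :=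
    (h₁ t (right_mem_Icc.2 hat.le)).symm.trans (h₂ t (left_mem_Icc.2 htb.le))
  rw [h, add_right_inj] at hc
  refine ⟨m₁, c₁, fun s hs => ?_⟩
  obtain hst | hts := le_total s t
  · exact h₁ s ⟨hs.1, hst⟩
  · rw [h₂ s ⟨hts, hs.2⟩, h, hc]

lemma isAffineOn_of_finite {S : Set ℝ} (hS : S.Finite)
    (hpiece : ∀ c d, a ≤ c → c ≤ d → d ≤ b → Disjoint (Ioo c d) S → IsAffineOn φ c d)
    (hjump : ∀ t ∈ Ioo a b, derivWithin φ (Ioi t) t = derivWithin φ (Iio t) t) (hab : a ≤ b) :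
    IsAffineOn φ a b := by
  induction S, hS using Set.Finite.induction_on with
  | empty => exact hpiece a b le_rfl hab le_rfl (disjoint_empty _)
  | @insert s S _ _ ih =>
    refine ih fun c d hac hcd hdb hdisj => ?_
    by_cases hs : s ∈ Ioo c d
    · refine (hpiece c s hac hs.1.le (hs.2.le.trans hdb) ?_).union
        (hpiece s d (hac.trans hs.1.le) hs.2.le hdb ?_) hs.1 hs.2
        (hjump s ⟨hac.trans_lt hs.1, hs.2.trans_le hdb⟩)
      · exact disjoint_insert_right.2
          ⟨right_notMem_Ioo, hdisj.mono_left (Ioo_subset_Ioo_right hs.2.le)⟩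
      · exact disjoint_insert_right.2
          ⟨left_notMem_Ioo, hdisj.mono_left (Ioo_subset_Ioo_left hs.1.le)⟩
    · exact hpiece c d hac hcd hdb (disjoint_insert_right.2 ⟨hs, hdisj⟩)

end IsAffineOn

section AffineOff

/-- Ohm's law on a circuit with terminals in `S`: `f` is affine on every segment of an edge whose
interior avoids `S`. -/
def AffineOff (S : Set G.Point) (f : G.Point → ℝ) : Prop :=
  ∀ (e : E) (a b : ℝ), 0 ≤ a → a ≤ b → b ≤ G.len e → (∀ t ∈ Ioo a b, G.point e t ∉ S) →
    IsAffineOn (fun t => f (G.point e t)) a b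

variable {G} {S T : Set G.Point} {f g : G.Point → ℝ}

lemma AffineOff.mono (hf : G.AffineOff S f) (hST : S ⊆ T) : G.AffineOff T f :=
  fun e a b ha hab hb h => hf e a b ha hab hb fun t ht htS => h t ht (hST htS)

lemma AffineOff.add_mul (hf : G.AffineOff S f) (hg : G.AffineOff S g) (k : ℝ) :
    G.AffineOff S fun x => f x + k * g x := by
  intro e a b ha hab hb h
  obtain ⟨m, c, hf⟩ := hf e a b ha hab hb h
  obtain ⟨m', c', hg⟩ := hg e a b ha hab hb h
  exact ⟨m + k * m', c + k * c', fun t ht => by simp only [hf t ht, hg t ht]; ring⟩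

lemma AffineOff.sub (hf : G.AffineOff S f) (hg : G.AffineOff S g) :
    G.AffineOff S fun x => f x - g x := by
  simpa only [neg_one_mul, ← sub_eq_add_neg] using hf.add_mul hg (-1)

lemma AffineOff.isAffineOn (hf : G.AffineOff S f) {e : E} {a b : ℝ} (ha : 0 ≤ a) (hab : a ≤ b)
    (hb : b ≤ G.len e) (h : Disjoint (Ioo a b) (G.coord e '' S)) :
    IsAffineOn (fun t => f (G.point e t)) a b :=
  hf e a b ha hab hb fun _ ht hS => disjoint_left.1 h ht
    ⟨_, hS, G.coord_point_self ⟨ha.trans ht.1.le, ht.2.trans_le hb⟩⟩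

lemma exists_Ioo_disjoint_right {S : Set ℝ} (hS : S.Finite) {t b : ℝ} (htb : t < b) :
    ∃ c ∈ Ioc t b, Disjoint (Ioo t c) S := by
  obtain ⟨c, hc, h⟩ := (mem_nhdsGT_iff_exists_mem_Ioc_Ioo_subset htb).1
    (nhdsGT_le_nhdsNE t (nhdsNE_le_cofinite t hS.compl_mem_cofinite))
  exact ⟨c, hc, subset_compl_iff_disjoint_right.1 h⟩

lemma exists_Ioo_disjoint_left {S : Set ℝ} (hS : S.Finite) {a t : ℝ} (hat : a < t) :
    ∃ c ∈ Ico a t, Disjoint (Ioo c t) S := by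
  obtain ⟨c, hc, h⟩ := (mem_nhdsLT_iff_exists_mem_Ico_Ioo_subset hat).1
    (nhdsLT_le_nhdsNE t (nhdsNE_le_cofinite t hS.compl_mem_cofinite))
  exact ⟨c, hc, subset_compl_iff_disjoint_right.1 h⟩

lemma AffineOff.differentiableWithinAt_Ioi (hf : G.AffineOff S f) (hS : S.Finite) {e : E} {t : ℝ}
    (ht : t ∈ Ico 0 (G.len e)) :
    DifferentiableWithinAt ℝ (fun s => f (G.point e s)) (Ioi t) t := by
  obtain ⟨b, hb, hdisj⟩ := exists_Ioo_disjoint_right (hS.image (G.coord e)) ht.2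
  obtain ⟨m, c, h⟩ := hf.isAffineOn ht.1 hb.1.le hb.2 hdisj
  exact (hasDerivWithinAt_Ioi_of_affine hb.1 h).differentiableWithinAt

lemma AffineOff.differentiableWithinAt_Iio (hf : G.AffineOff S f) (hS : S.Finite) {e : E} {t : ℝ}
    (ht : t ∈ Ioc 0 (G.len e)) :
    DifferentiableWithinAt ℝ (fun s => f (G.point e s)) (Iio t) t := by
  obtain ⟨a, ha, hdisj⟩ := exists_Ioo_disjoint_left (hS.image (G.coord e)) ht.1
  obtain ⟨m, c, h⟩ := hf.isAffineOn ha.1 ha.2.le ht.2 hdisj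
  exact (hasDerivWithinAt_Iio_of_affine ha.2 h).differentiableWithinAt

variable (G)

lemma interpolate_affine (u : V → ℝ) (e : E) {t : ℝ} (ht : t ∈ Icc 0 (G.len e)) :
    G.interpolate u (G.point e t) = (u (G.tgt e) - u (G.src e)) / G.len e * t + u (G.src e) := by
  rw [G.interpolate_point u ht]
  simp only [smul_eq_mul]
  ring

lemma affineOff_interpolate (u : V → ℝ) : G.AffineOff ∅ (G.interpolate u) :=
  fun e _ _ ha _ hb _ => ⟨_, _, fun _ ht => G.interpolate_affine u e (Icc_subset_Icc ha hb ht)⟩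

lemma hat_eq_of_le_left (e : E) {s t : ℝ} (h : t ≤ s) :
    G.hat e t s = (1 - s / G.len e) * t + 0 := by
  rw [hat, min_eq_left h]
  ring

lemma hat_eq_of_le_right (e : E) {s t : ℝ} (h : s ≤ t) :
    G.hat e t s = -(s / G.len e) * t + s := by
  rw [hat, min_eq_right h]
  ring

lemma affineOff_hat {e : E} {s : ℝ} (hs : s ∈ Ioo 0 (G.len e)) :
    G.AffineOff {G.point e s} fun x => G.hat e (G.coord e x) s := by
  intro e' a b ha _ hb h
  obtain rfl | he := eq_or_ne e' e
  · have hc {t : ℝ} (ht : t ∈ Icc a b) := G.hat_coord_point (Icc_subset_Icc ha hb ht)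
      (Ioo_subset_Icc_self hs)
    obtain has | hsa := le_or_gt s a
    · exact ⟨_, _, fun t ht => (hc ht).trans (G.hat_eq_of_le_right e' (has.trans ht.1))⟩
    · have hbs : b ≤ s := not_lt.1 fun hsb => h s ⟨hsa, hsb⟩ rfl
      exact ⟨_, _, fun t ht => (hc ht).trans (G.hat_eq_of_le_left e' (ht.2.trans hbs))⟩
  · exact ⟨0, 0, fun t _ => by simp [G.hat_coord_point_of_ne he _ hs.1.le]⟩

end AffineOff

/-! ### The sum of the slopes at a point -/

section slope

/-- The slope of `f` on `e` at the parameter `t`, in the forward direction. -/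
def slopeRight (f : G.Point → ℝ) (e : E) (t : ℝ) : ℝ :=
  derivWithin (fun s => f (G.point e s)) (Ioi t) t

/-- The derivative of `f` on `e` from the left at the parameter `t`, which is minus the slope in
the backward direction. -/
def slopeLeft (f : G.Point → ℝ) (e : E) (t : ℝ) : ℝ :=
  derivWithin (fun s => f (G.point e s)) (Iio t) t

lemma point_eq_vertex_iff_src {e : E} {t : ℝ} (v : V) :
    t ∈ Ico 0 (G.len e) ∧ G.point e t = G.vertex v ↔ t = 0 ∧ G.src e = v := by
  constructor
  · rintro ⟨ht, h⟩
    obtain rfl | h0 := ht.1.eq_or_lt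
    · exact ⟨rfl, G.vertex_injective ((G.point_zero e).symm.trans h)⟩
    · exact absurd h (G.point_ne_vertex ⟨h0, ht.2⟩ v)
  · rintro ⟨rfl, rfl⟩
    exact ⟨left_mem_Ico.2 (G.len_pos e), G.point_zero e⟩

lemma point_eq_vertex_iff_tgt {e : E} {t : ℝ} (v : V) :
    t ∈ Ioc 0 (G.len e) ∧ G.point e t = G.vertex v ↔ t = G.len e ∧ G.tgt e = v := by
  constructor
  · rintro ⟨ht, h⟩
    obtain rfl | h0 := ht.2.eq_or_lt
    · exact ⟨rfl, G.vertex_injective ((G.point_len e).symm.trans h)⟩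
    · exact absurd h (G.point_ne_vertex ⟨ht.1, h0⟩ v)
  · rintro ⟨rfl, rfl⟩
    exact ⟨right_mem_Ioc.2 (G.len_pos e), G.point_len e⟩

lemma point_eq_point_iff {e e' : E} {s t : ℝ} (hs : s ∈ Icc 0 (G.len e'))
    (ht : t ∈ Ioo 0 (G.len e)) : G.point e' s = G.point e t ↔ e' = e ∧ s = t := by
  refine ⟨fun h => ?_, by rintro ⟨rfl, rfl⟩; rfl⟩
  obtain rfl := G.edge_eq_of_point_eq ht h
  have hsL : s ≠ G.len e' := by
    rintro rfl
    exact G.point_ne_vertex ht _ (h.symm.trans (G.point_len e'))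
  rw [eq_comm, G.point_eq_iff_coord ht, G.coord_point_self ⟨hs.1, hs.2.lt_of_ne hsL⟩] at h
  exact ⟨rfl, h⟩

variable [Fintype E]

open Classical in
lemma slopeSum_vertex (f : G.Point → ℝ) (v : V) :
    G.slopeSum f (G.vertex v) =
      ∑ e, (G.slopeRight f e 0 * Pi.single (M := fun _ => ℝ) (G.src e) 1 v -
        G.slopeLeft f e (G.len e) * Pi.single (M := fun _ => ℝ) (G.tgt e) 1 v) := by
  refine Finset.sum_congr rfl fun e _ => ?_
  simp only [point_eq_vertex_iff_src, point_eq_vertex_iff_tgt, Pi.single_apply, @eq_comm V v]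
  congr 1
  · by_cases h : G.src e = v <;> simp [h, slopeRight]
  · by_cases h : G.tgt e = v <;> simp [h, slopeLeft]

lemma slopeSum_point (f : G.Point → ℝ) {e : E} {t : ℝ} (ht : t ∈ Ioo 0 (G.len e)) :
    G.slopeSum f (G.point e t) = G.slopeRight f e t - G.slopeLeft f e t := by
  have hright (s : ℝ) : s ∈ Ico 0 (G.len e) ∧ G.point e s = G.point e t ↔ s = t :=
    ⟨fun h => ((G.point_eq_point_iff (Ico_subset_Icc_self h.1) ht).1 h.2).2, by
      rintro rfl; exact ⟨Ioo_subset_Ico_self ht, rfl⟩⟩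
  have hleft (s : ℝ) : s ∈ Ioc 0 (G.len e) ∧ G.point e s = G.point e t ↔ s = t :=
    ⟨fun h => ((G.point_eq_point_iff (Ioc_subset_Icc_self h.1) ht).1 h.2).2, by
      rintro rfl; exact ⟨Ioo_subset_Ioc_self ht, rfl⟩⟩
  rw [slopeSum, Finset.sum_eq_single e]
  · simp only [hright, hleft, finsum_cond_eq_left, slopeRight, slopeLeft]
  · intro e' _ he
    have hne (s : ℝ) : G.point e' s ≠ G.point e t := fun h => he (G.edge_eq_of_point_eq ht h)
    simp [hne]
  · simp

lemma slopeSum_add_const (f : G.Point → ℝ) (c : ℝ) (a : G.Point) :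
    G.slopeSum (fun x => f x + c) a = G.slopeSum f a := by
  simp only [slopeSum, derivWithin_add_const]

variable {G} {S : Set G.Point} {f g : G.Point → ℝ}

lemma AffineOff.slopeSum_add_mul (hf : G.AffineOff S f) (hg : G.AffineOff S g) (hS : S.Finite)
    (k : ℝ) (a : G.Point) :
    G.slopeSum (fun x => f x + k * g x) a = G.slopeSum f a + k * G.slopeSum g a := by
  have hright {e : E} {t : ℝ} (ht : t ∈ Ico 0 (G.len e)) :
      G.slopeRight (fun x => f x + k * g x) e t = G.slopeRight f e t + k * G.slopeRight g e t := by
    have hg' := hg.differentiableWithinAt_Ioi hS ht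
    rw [slopeRight, derivWithin_fun_add (hf.differentiableWithinAt_Ioi hS ht) (hg'.const_mul k),
      derivWithin_const_mul_field]
    rfl
  have hleft {e : E} {t : ℝ} (ht : t ∈ Ioc 0 (G.len e)) :
      G.slopeLeft (fun x => f x + k * g x) e t = G.slopeLeft f e t + k * G.slopeLeft g e t := by
    have hg' := hg.differentiableWithinAt_Iio hS ht
    rw [slopeLeft, derivWithin_fun_add (hf.differentiableWithinAt_Iio hS ht) (hg'.const_mul k),
      derivWithin_const_mul_field]
    rfl
  obtain ⟨v, rfl⟩ | ⟨e, t, ht, rfl⟩ := G.exists_vertex_or_point a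
  · rw [slopeSum_vertex, slopeSum_vertex, slopeSum_vertex, Finset.mul_sum,
      ← Finset.sum_add_distrib]
    refine Finset.sum_congr rfl fun e _ => ?_
    rw [hright (left_mem_Ico.2 (G.len_pos e)), hleft (right_mem_Ioc.2 (G.len_pos e))]
    ring
  · rw [slopeSum_point G _ ht, slopeSum_point G _ ht, slopeSum_point G _ ht,
      hright (Ioo_subset_Ico_self ht), hleft (Ioo_subset_Ioc_self ht)]
    ring

lemma AffineOff.slopeSum_sub (hf : G.AffineOff S f) (hg : G.AffineOff S g) (hS : S.Finite)
    (a : G.Point) : G.slopeSum (fun x => f x - g x) a = G.slopeSum f a - G.slopeSum g a := by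
  simpa only [neg_one_mul, ← sub_eq_add_neg] using hf.slopeSum_add_mul hg hS (-1) a

lemma AffineOff.slopeSum_eq_zero (hf : G.AffineOff S f) (hS : S.Finite) {e : E} {t : ℝ}
    (ht : t ∈ Ioo 0 (G.len e)) (htS : G.point e t ∉ S) : G.slopeSum f (G.point e t) = 0 := by
  have htS' : t ∉ G.coord e '' S := by
    rintro ⟨y, hy, hyt⟩
    exact htS ((G.point_eq_iff_coord ht y).2 hyt ▸ hy)
  obtain ⟨a, b, hab, hsub⟩ := mem_nhds_iff_exists_Ioo_subset.1 <| inter_mem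
    (Ioo_mem_nhds ht.1 ht.2) ((hS.image (G.coord e)).isClosed.compl_mem_nhds htS')
  obtain ⟨hab0, habS⟩ := subset_inter_iff.1 hsub
  obtain ⟨ha, hb⟩ := (Ioo_subset_Ioo_iff (hab.1.trans hab.2)).1 hab0
  obtain ⟨m, c, h⟩ :=
    hf.isAffineOn ha (hab.1.trans hab.2).le hb (subset_compl_iff_disjoint_right.1 habS)
  rw [slopeSum_point G f ht, slopeRight, slopeLeft,
    derivWithin_Ioi_of_affine hab.2 fun s hs => h s ⟨hab.1.le.trans hs.1, hs.2⟩,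
    derivWithin_Iio_of_affine hab.1 fun s hs => h s ⟨hs.1, hs.2.trans hab.2.le⟩, sub_self]

variable (G)

lemma slopeSum_interpolate_vertex (u : V → ℝ) (v : V) :
    G.slopeSum (G.interpolate u) (G.vertex v) = -G.laplacian u v := by
  rw [slopeSum_vertex, laplacian_apply, Finset.sum_apply, ← Finset.sum_neg_distrib]
  refine Finset.sum_congr rfl fun e _ => ?_
  have h (t : ℝ) (ht : t ∈ Icc 0 (G.len e)) := G.interpolate_affine u e ht
  rw [slopeRight, slopeLeft, derivWithin_Ioi_of_affine (G.len_pos e) h,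
    derivWithin_Iio_of_affine (G.len_pos e) h]
  simp only [incidence, Pi.smul_apply, Pi.sub_apply, smul_eq_mul]
  ring

lemma slopeSum_hat_vertex {e : E} {s : ℝ} (hs : s ∈ Ioo 0 (G.len e)) (v : V) :
    G.slopeSum (fun x => G.hat e (G.coord e x) s) (G.vertex v) = G.weight (G.point e s) v := by
  rw [slopeSum_vertex, Finset.sum_eq_single e, slopeRight, slopeLeft,
    derivWithin_Ioi_of_affine hs.1 fun t ht =>
      (G.hat_coord_point ⟨ht.1, ht.2.trans hs.2.le⟩ (Ioo_subset_Icc_self hs)).trans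
        (G.hat_eq_of_le_left e ht.2),
    derivWithin_Iio_of_affine hs.2 fun t ht =>
      (G.hat_coord_point ⟨hs.1.le.trans ht.1, ht.2⟩ (Ioo_subset_Icc_self hs)).trans
        (G.hat_eq_of_le_right e ht.1),
    weight, G.interpolate_point _ (Ioo_subset_Icc_self hs)]
  · simp
  · intro e' _ he
    simp [slopeRight, slopeLeft, G.hat_coord_point_of_ne he _ hs.1.le]
  · simp

lemma slopeSum_hat_self {e : E} {s : ℝ} (hs : s ∈ Ioo 0 (G.len e)) :
    G.slopeSum (fun x => G.hat e (G.coord e x) s) (G.point e s) = -1 := by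
  rw [slopeSum_point G _ hs, slopeRight, slopeLeft,
    derivWithin_Ioi_of_affine hs.2 fun t ht =>
      (G.hat_coord_point ⟨hs.1.le.trans ht.1, ht.2⟩ (Ioo_subset_Icc_self hs)).trans
        (G.hat_eq_of_le_right e ht.1),
    derivWithin_Iio_of_affine hs.1 fun t ht =>
      (G.hat_coord_point ⟨ht.1, ht.2.trans hs.2.le⟩ (Ioo_subset_Icc_self hs)).trans
        (G.hat_eq_of_le_left e ht.2)]
  ring

end slope

/-! ### Voltage and resistance in terms of the kernel -/

section slopeSum_kernel

variable [Fintype V] [Fintype E]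

lemma affineOff_kernel (y : G.Point) : G.AffineOff {y} fun x => G.kernel x y := by
  obtain ⟨v, rfl⟩ | ⟨e, s, hs, rfl⟩ := G.exists_vertex_or_point y
  · simp only [kernel_vertex_right]
    exact (G.affineOff_interpolate _).mono (empty_subset _)
  · simp only [G.kernel_point_right _ (Ioo_subset_Icc_self hs)]
    simpa only [one_mul] using
      ((G.affineOff_interpolate _).mono (empty_subset _)).add_mul (G.affineOff_hat hs) 1

lemma slopeSum_interpolate_potential_weight (y : G.Point) (v : V) :
    G.slopeSum (G.interpolate (G.potential (G.weight y))) (G.vertex v) =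
      1 / Fintype.card V - G.weight y v := by
  rw [slopeSum_interpolate_vertex, laplacian_potential, sum_weight, neg_sub]

lemma slopeSum_kernel_point {e : E} {s : ℝ} (hs : s ∈ Ioo 0 (G.len e)) (a : G.Point) :
    G.slopeSum (fun x => G.kernel x (G.point e s)) a =
      G.slopeSum (G.interpolate (G.potential (G.weight (G.point e s)))) a +
        G.slopeSum (fun x => G.hat e (G.coord e x) s) a := by
  simp only [G.kernel_point_right _ (Ioo_subset_Icc_self hs)]
  simpa only [one_mul] using ((G.affineOff_interpolate _).mono (empty_subset _)).slopeSum_add_mul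
    (G.affineOff_hat hs) (finite_singleton _) 1 a

lemma neg_slopeSum_kernel (y a : G.Point) :
    -G.slopeSum (fun x => G.kernel x y) a =
      indicator {y} (fun _ => (1 : ℝ)) a -
        indicator (range G.vertex) (fun _ => (1 : ℝ) / Fintype.card V) a := by
  classical
  obtain ⟨v, rfl⟩ | ⟨e, t, ht, rfl⟩ := G.exists_vertex_or_point a
  · rw [indicator_of_mem (mem_range_self v)]
    obtain ⟨w, rfl⟩ | ⟨e', s, hs, rfl⟩ := G.exists_vertex_or_point y
    · simp only [kernel_vertex_right]
      rw [slopeSum_interpolate_potential_weight, neg_sub, weight, interpolate_vertex]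
      simp [indicator_apply, Pi.single_apply, G.vertex_injective.eq_iff]
    · rw [slopeSum_kernel_point G hs, slopeSum_interpolate_potential_weight,
        G.slopeSum_hat_vertex hs,
        indicator_of_notMem (mt mem_singleton_iff.1 (G.point_ne_vertex hs v).symm)]
      ring
  · have hrange : G.point e t ∉ range G.vertex := by
      rintro ⟨v, hv⟩
      exact G.point_ne_vertex ht v hv.symm
    rw [indicator_of_notMem hrange, sub_zero]
    by_cases hy : G.point e t = y
    · subst hy
      rw [slopeSum_kernel_point G ht, G.slopeSum_hat_self ht,
        (G.affineOff_interpolate _).slopeSum_eq_zero finite_empty ht (notMem_empty _)]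
      simp
    · rw [(G.affineOff_kernel y).slopeSum_eq_zero (finite_singleton y) ht hy, neg_zero,
        indicator_of_notMem (mt mem_singleton_iff.1 hy)]

end slopeSum_kernel

section harmonic

variable [Fintype E]

variable {G} in
lemma AffineOff.eq_interpolate {S : Set G.Point} {f : G.Point → ℝ} (hf : G.AffineOff S f)
    (hS : S.Finite) (h : ∀ a, G.slopeSum f a = 0) :
    f = G.interpolate fun v => f (G.vertex v) := by
  have hvertex (v : V) : f (G.vertex v) = G.interpolate (fun v => f (G.vertex v)) (G.vertex v) :=
    rfl
  funext x
  obtain ⟨v, rfl⟩ | ⟨e, t, ht, rfl⟩ := G.exists_vertex_or_point x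
  · exact hvertex v
  have hL := (G.len_pos e).le
  obtain ⟨m, c, haff⟩ := isAffineOn_of_finite (hS.image (G.coord e))
    (fun _ _ ha hab hb => hf.isAffineOn ha hab hb)
    (fun s hs => sub_eq_zero.1 ((G.slopeSum_point f hs).symm.trans (h _))) hL
  have hp := haff 0 (left_mem_Icc.2 hL)
  have hq := haff (G.len e) (right_mem_Icc.2 hL)
  simp only [point_zero, point_len, p, q] at hp hq
  rw [show f (G.point e t) = m * t + c from haff t (Ioo_subset_Icc_self ht),
    G.interpolate_affine _ e (Ioo_subset_Icc_self ht), hp, hq]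
  field_simp [(G.len_pos e).ne']
  ring

variable {G} in
lemma AffineOff.eq_of_slopeSum_eq_zero [Finite V] {S : Set G.Point} {f : G.Point → ℝ}
    (hf : G.AffineOff S f) (hS : S.Finite) (h : ∀ a, G.slopeSum f a = 0) (x y : G.Point) :
    f x = f y := by
  have hinterp := hf.eq_interpolate hS h
  have hlap : G.laplacian (fun v => f (G.vertex v)) = 0 := funext fun v => by
    rw [← neg_inj, ← slopeSum_interpolate_vertex, ← hinterp, h, Pi.zero_apply, neg_zero]
  have hconst (x : G.Point) (v : V) : f x = f (G.vertex v) := by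
    have hvertex : (fun w => f (G.vertex w)) = fun _ => f (G.vertex v) :=
      funext fun w => G.eq_of_laplacian_eq_zero hlap w v
    rw [hinterp, hvertex]
    exact G.interpolate_const _ x
  obtain ⟨v, rfl⟩ | ⟨e, -, -, -⟩ := G.exists_vertex_or_point y
  · exact hconst x v
  · rw [hconst x (G.src e), hconst y (G.src e)]

end harmonic

section voltage

variable [Fintype E]

variable {G} in
lemma IsVoltage.affineOff {z y : G.Point} {f : G.Point → ℝ} (hf : G.IsVoltage z y f) :
    G.AffineOff {y, z} f :=
  fun e a b ha hab hb h => hf.affine e a b ha hab hb fun t ht => not_or.1 (h t ht)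

variable {G} in
lemma IsVoltage.unique [Finite V] {z y : G.Point} {f g : G.Point → ℝ} (hf : G.IsVoltage z y f)
    (hg : G.IsVoltage z y g) : f = g := by
  have hS : ({y, z} : Set G.Point).Finite := toFinite _
  have hslope (a : G.Point) : G.slopeSum (fun x => f x - g x) a = 0 := by
    rw [hf.affineOff.slopeSum_sub hg.affineOff hS, sub_eq_zero, ← neg_inj, hf.kirchhoff,
      hg.kirchhoff]
  funext x
  have h := (hf.affineOff.sub hg.affineOff).eq_of_slopeSum_eq_zero hS hslope x z
  rwa [hf.ground, hg.ground, sub_self, sub_eq_zero] at h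

variable [Fintype V]

lemma isVoltage_kernel (z y : G.Point) :
    G.IsVoltage z y fun x => G.kernel x y - G.kernel x z + (G.kernel z z - G.kernel z y) := by
  have hy := (G.affineOff_kernel y).mono (T := {y, z}) (by simp)
  have hz := (G.affineOff_kernel z).mono (T := {y, z}) (by simp)
  refine ⟨fun e a b ha hab hb h => ?_, fun a => ?_, by ring⟩
  · obtain ⟨m, c, hmc⟩ := hy.sub hz e a b ha hab hb fun t ht => not_or.2 (h t ht)
    exact ⟨m, c + (G.kernel z z - G.kernel z y), fun t ht => by
      rw [← add_assoc]
      exact congrArg (· + _) (hmc t ht)⟩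
  · rw [slopeSum_add_const, hy.slopeSum_sub hz (toFinite _), neg_sub', neg_slopeSum_kernel,
      neg_slopeSum_kernel, sub_sub_sub_cancel_right]

lemma voltage_eq (z x y : G.Point) :
    G.voltage z x y = G.kernel x y - G.kernel x z + (G.kernel z z - G.kernel z y) :=
  congrFun ((Classical.epsilon_spec ⟨_, G.isVoltage_kernel z y⟩).unique
    (G.isVoltage_kernel z y)) x

lemma resistance_eq (x y : G.Point) :
    G.resistance x y = G.kernel x x - 2 * G.kernel x y + G.kernel y y := by
  rw [resistance, voltage_eq, G.kernel_comm y x]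
  ring

end voltage

section resistance

variable [Finite V] [Fintype E]

lemma resistance_comm (x y : G.Point) : G.resistance x y = G.resistance y x := by
  have := Fintype.ofFinite V
  rw [resistance_eq, resistance_eq, G.kernel_comm y x]
  ring

lemma resistance_point_of_mem_deleteEdge {a : G.Point} {e : E} {t : ℝ} (ha : a ∈ G.deleteEdge e)
    (ht : t ∈ Icc 0 (G.len e)) :
    G.resistance a (G.point e t) =
      G.resistance a (G.p e) +
      t * ((G.len e - G.resistance (G.p e) (G.q e) + G.resistance a (G.q e)
        - G.resistance a (G.p e)) / G.len e) -
      t ^ 2 * ((G.len e - G.resistance (G.p e) (G.q e)) / G.len e ^ 2) := by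
  have := Fintype.ofFinite V
  have hL := (G.len_pos e).ne'
  have hhat : G.hat e t (G.coord e a) = 0 := by
    rw [G.mem_deleteEdge_iff_coord.1 ha, hat_comm, G.hat_zero_left e ht.1]
  simp only [resistance_eq]
  rw [G.kernel_comm a (G.point e t), G.kernel_point ht, G.kernel_point_self ht, hhat,
    G.kernel_comm (G.p e) a, G.kernel_comm (G.q e) a, hat, min_self]
  field_simp
  ring

end resistance

/-! ### The canonical measure -/

section integral

variable {X : Type*} [MeasurableSpace X]

instance isFiniteMeasure_variation (μ : SignedMeasure X) :
    IsFiniteMeasure (VectorMeasure.variation μ) := by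
  rw [← SignedMeasure.totalVariation_eq_variation]
  infer_instance

lemma integral_const_signedMeasure (μ : SignedMeasure X) (c : ℝ) :
    (∫ᵛ _, c ∂•μ) = c * μ univ := by
  rw [VectorMeasure.integral_const]
  rfl

lemma integrable_of_continuous [TopologicalSpace X] [CompactSpace X] [OpensMeasurableSpace X]
    (μ : SignedMeasure X) {f : X → ℝ} (hf : Continuous f) : μ.Integrable f := by
  obtain ⟨C, hC⟩ := (isCompact_range hf).isBounded.exists_norm_le
  exact Integrable.of_bound hf.aestronglyMeasurable C
    (Filter.Eventually.of_forall fun x => hC _ (mem_range_self x))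

end integral

/-- The Lebesgue measure of the edge `e`. -/
def edgeMeasure (e : E) : SignedMeasure G.Point :=
  ((volume.restrict (Ioc 0 (G.len e))).map (G.point e)).toSignedMeasure

lemma integral_edgeMeasure (e : E) {f : G.Point → ℝ} (hf : Continuous f) :
    (∫ᵛ x, f x ∂•(G.edgeMeasure e)) = ∫ t in 0..G.len e, f (G.point e t) := by
  have hflip : (ContinuousLinearMap.lsmul ℝ ℝ : ℝ →L[ℝ] ℝ →L[ℝ] ℝ) =
      (ContinuousLinearMap.lsmul ℝ ℝ).flip := by ext; simp
  rw [hflip, edgeMeasure, VectorMeasure.integral_toSignedMeasure,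
    integral_map (G.continuous_point e).aemeasurable hf.aestronglyMeasurable,
    intervalIntegral.integral_of_le (G.len_pos e).le]

/-- The Lebesgue measure of the edge `e`, swept out to the end points of `e`: the signed measure of
mass `0` whose potential is supported on `e`. -/
def sweptEdgeMeasure (e : E) : SignedMeasure G.Point :=
  G.edgeMeasure e - (VectorMeasure.dirac (G.p e) (G.len e / 2) +
    VectorMeasure.dirac (G.q e) (G.len e / 2))

section sweptEdgeMeasure

variable [Finite V] [Finite E]

lemma integral_sweptEdgeMeasure (e : E) {f : G.Point → ℝ} (hf : Continuous f) :
    (∫ᵛ x, f x ∂•(G.sweptEdgeMeasure e)) =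
      (∫ t in 0..G.len e, f (G.point e t)) - G.len e / 2 * (f (G.p e) + f (G.q e)) := by
  have hi (μ : SignedMeasure G.Point) := integrable_of_continuous μ hf
  rw [sweptEdgeMeasure, VectorMeasure.integral_sub_vectorMeasure (hi _) (hi _),
    VectorMeasure.integral_add_vectorMeasure (hi _) (hi _), G.integral_edgeMeasure e hf,
    VectorMeasure.integral_dirac' hf.stronglyMeasurable,
    VectorMeasure.integral_dirac' hf.stronglyMeasurable]
  simp only [ContinuousLinearMap.lsmul_apply, smul_eq_mul]
  ring

lemma sweptEdgeMeasure_univ (e : E) : G.sweptEdgeMeasure e univ = 0 := by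
  have h := G.integral_sweptEdgeMeasure e (f := fun _ => 1) continuous_const
  rw [integral_const_signedMeasure, one_mul, intervalIntegral.integral_const] at h
  rw [h, smul_eq_mul]
  ring

end sweptEdgeMeasure

lemma integral_hat (e : E) {c : ℝ} (hc : c ∈ Icc 0 (G.len e)) :
    ∫ t in 0..G.len e, G.hat e t c = G.len e / 2 * G.hat e c c := by
  have hi (a b : ℝ) : IntervalIntegrable (fun t => G.hat e t c) volume a b :=
    (by unfold hat; fun_prop : Continuous fun t => G.hat e t c).intervalIntegrable a b
  have hlin (m k a b : ℝ) : ∫ t in a..b, (m * t + k) = m * ((b ^ 2 - a ^ 2) / 2) + k * (b - a) := by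
    rw [intervalIntegral.integral_add (by apply Continuous.intervalIntegrable; fun_prop)
      (by apply Continuous.intervalIntegrable; fun_prop),
      intervalIntegral.integral_const_mul, integral_id, intervalIntegral.integral_const,
      smul_eq_mul, mul_comm k]
  have hleft : ∫ t in 0..c, G.hat e t c = ∫ t in 0..c, ((1 - c / G.len e) * t + 0) :=
    intervalIntegral.integral_congr fun t ht =>
      G.hat_eq_of_le_left e (uIcc_of_le hc.1 ▸ ht).2
  have hright : ∫ t in c..G.len e, G.hat e t c = ∫ t in c..G.len e, (-(c / G.len e) * t + c) :=
    intervalIntegral.integral_congr fun t ht =>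
      G.hat_eq_of_le_right e (uIcc_of_le hc.2 ▸ ht).1
  rw [← intervalIntegral.integral_add_adjacent_intervals (hi 0 c) (hi c _), hleft, hright, hlin,
    hlin, hat, min_self]
  field_simp [(G.len_pos e).ne']
  ring

section canonical

variable [Fintype V] [Fintype E]

lemma integral_kernel_sweptEdgeMeasure (e : E) (x : G.Point) :
    (∫ᵛ z, G.kernel z x ∂•(G.sweptEdgeMeasure e)) =
      G.len e / 2 * G.hat e (G.coord e x) (G.coord e x) := by
  have hL := G.len_pos e
  have hkernel : ∫ t in 0..G.len e, G.kernel (G.point e t) x =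
      ∫ t in 0..G.len e, ((1 - t / G.len e) * G.kernel (G.p e) x +
        t / G.len e * G.kernel (G.q e) x + G.hat e t (G.coord e x)) :=
    intervalIntegral.integral_congr fun t ht => G.kernel_point (uIcc_of_le hL.le ▸ ht) x
  rw [G.integral_sweptEdgeMeasure e (G.continuous_kernel x), hkernel,
    intervalIntegral.integral_add (by apply Continuous.intervalIntegrable; fun_prop)
      (by apply Continuous.intervalIntegrable; unfold hat; fun_prop),
    intervalIntegral.integral_add (by apply Continuous.intervalIntegrable; fun_prop)
      (by apply Continuous.intervalIntegrable; fun_prop),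
    G.integral_hat e (Ico_subset_Icc_self (G.coord_mem_Ico e x))]
  simp only [intervalIntegral.integral_mul_const]
  rw [intervalIntegral.integral_sub intervalIntegrable_const
    (by apply Continuous.intervalIntegrable; fun_prop)]
  simp only [intervalIntegral.integral_const, intervalIntegral.integral_div, integral_id,
    smul_eq_mul]
  field_simp
  ring

lemma voltageIntegral_eq {μ : SignedMeasure G.Point} (hμ : μ univ = 1) (x y : G.Point) :
    G.voltageIntegral μ x y =
      G.kernel x y - (∫ᵛ z, G.kernel z x ∂•μ) +
        ((∫ᵛ z, G.kernel z z ∂•μ) - ∫ᵛ z, G.kernel z y ∂•μ) := by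
  have hi {f : G.Point → ℝ} (hf : Continuous f) : μ.Integrable f := integrable_of_continuous μ hf
  have hx := G.continuous_kernel x
  have hy := G.continuous_kernel y
  have hself := G.continuous_kernel_self
  simp only [voltageIntegral, voltage_eq, G.kernel_comm x]
  rw [VectorMeasure.integral_fun_add (hi (by fun_prop)) (hi (by fun_prop)),
    VectorMeasure.integral_fun_sub (hi (by fun_prop)) (hi hx),
    VectorMeasure.integral_fun_sub (hi hself) (hi hy), integral_const_signedMeasure, hμ, mul_one]

/-- The masses at the vertices in the closed form of the canonical measure: their kernel potential
must match the part of `1 / 2 * K(x, x)`, for `K` the kernel, that is affine on the edges. -/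
def canonicalVertexMass : V → ℝ :=
  (1 / 2 : ℝ) • G.laplacian (fun v => G.kernel (G.vertex v) (G.vertex v)) +
    fun _ => 1 / (Fintype.card V : ℝ)

/-- The canonical measure in closed form; its density on an edge `e` of length `L` is
`(1 - r(p, q) / L) / L`. -/
def explicitCanonicalMeasure : SignedMeasure G.Point :=
  ∑ v, VectorMeasure.dirac (G.vertex v) (G.canonicalVertexMass v) +
    ∑ e, ((1 - G.resistance (G.p e) (G.q e) / G.len e) / G.len e) • G.sweptEdgeMeasure e

lemma integral_explicitCanonicalMeasure {f : G.Point → ℝ} (hf : Continuous f) :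
    (∫ᵛ x, f x ∂•G.explicitCanonicalMeasure) =
      G.canonicalVertexMass ⬝ᵥ (fun v => f (G.vertex v)) +
      ∑ e, (1 - G.resistance (G.p e) (G.q e) / G.len e) / G.len e *
        ∫ᵛ x, f x ∂•(G.sweptEdgeMeasure e) := by
  have hi (μ : SignedMeasure G.Point) := integrable_of_continuous μ hf
  rw [explicitCanonicalMeasure, VectorMeasure.integral_add_vectorMeasure (hi _) (hi _),
    VectorMeasure.integral_finsetSum_vectorMeasure fun _ _ => hi _,
    VectorMeasure.integral_finsetSum_vectorMeasure fun _ _ => hi _, dotProduct]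
  simp only [VectorMeasure.integral_dirac' hf.stronglyMeasurable,
    VectorMeasure.integral_smul_vectorMeasure, ContinuousLinearMap.lsmul_apply, smul_eq_mul,
    mul_comm]

lemma explicitCanonicalMeasure_univ [Nonempty V] : G.explicitCanonicalMeasure univ = 1 := by
  have h := G.integral_explicitCanonicalMeasure (f := fun _ => 1) continuous_const
  simp only [integral_const_signedMeasure, one_mul, sweptEdgeMeasure_univ, mul_zero,
    Finset.sum_const_zero, add_zero] at h
  rw [h]
  simp [canonicalVertexMass, dotProduct, Finset.sum_add_distrib, ← Finset.mul_sum, sum_laplacian]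

lemma exists_canonicalVertexMass_dotProduct_kernel :
    ∃ c, ∀ x, (G.canonicalVertexMass ⬝ᵥ fun v => G.kernel (G.vertex v) x) =
      1 / 2 * G.interpolate (fun v => G.kernel (G.vertex v) (G.vertex v)) x + c := by
  set u : V → ℝ := fun v => G.kernel (G.vertex v) (G.vertex v)
  have hpot : G.potential G.canonicalVertexMass =
      (1 / 2 : ℝ) • u + fun _ => (1 / Fintype.card V - 1 / 2 * ∑ v, u v) / Fintype.card V :=
    funext fun v => by
      simp only [canonicalVertexMass, map_add, map_smul, Pi.add_apply, Pi.smul_apply,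
        potential_laplacian, potential_const, smul_eq_mul, u]
      ring
  refine ⟨(1 / Fintype.card V - 1 / 2 * ∑ v, u v) / Fintype.card V, fun x => ?_⟩
  simp only [kernel_vertex]
  rw [dotProduct_potential_comm, hpot, dotProduct_add, dotProduct_smul, weight_dotProduct,
    weight_dotProduct, interpolate_const, smul_eq_mul]

lemma exists_integral_kernel_explicitCanonicalMeasure :
    ∃ c, ∀ x, (∫ᵛ z, G.kernel z x ∂•G.explicitCanonicalMeasure) = 1 / 2 * G.kernel x x + c := by
  obtain ⟨c, hc⟩ := G.exists_canonicalVertexMass_dotProduct_kernel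
  refine ⟨c, fun x => ?_⟩
  rw [G.integral_explicitCanonicalMeasure (G.continuous_kernel x), hc, kernel_self, mul_add,
    add_right_comm, Finset.mul_sum]
  congr 2
  refine Finset.sum_congr rfl fun e _ => ?_
  rw [integral_kernel_sweptEdgeMeasure, resistance_eq]
  field_simp [(G.len_pos e).ne']

end canonical

section green

variable [Finite V] [Fintype E]

lemma exists_isCanonicalMeasure [Nonempty V] : ∃ μ, G.IsCanonicalMeasure μ := by
  have := Fintype.ofFinite V
  obtain ⟨c, hc⟩ := G.exists_integral_kernel_explicitCanonicalMeasure
  refine ⟨G.explicitCanonicalMeasure, G.explicitCanonicalMeasure_univ,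
    (∫ᵛ z, G.kernel z z ∂•G.explicitCanonicalMeasure) - 2 * c, fun x => ?_⟩
  rw [G.voltageIntegral_eq G.explicitCanonicalMeasure_univ, hc]
  ring

lemma continuous_resistance_left (y : G.Point) : Continuous fun x => G.resistance x y := by
  have := Fintype.ofFinite V
  simp only [resistance_eq]
  exact (G.continuous_kernel_self.sub ((G.continuous_kernel y).const_mul 2)).add continuous_const

lemma two_mul_voltageIntegral {μ : SignedMeasure G.Point} (hμ : μ univ = 1) (x y : G.Point) :
    2 * G.voltageIntegral μ x y =
      G.voltageIntegral μ x x + G.voltageIntegral μ y y - G.resistance x y := by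
  have := Fintype.ofFinite V
  rw [resistance_eq, G.voltageIntegral_eq hμ, G.voltageIntegral_eq hμ, G.voltageIntegral_eq hμ]
  ring

variable [Nonempty V]

lemma isCanonicalMeasure_canonicalMeasure : G.IsCanonicalMeasure G.canonicalMeasure :=
  Classical.epsilon_spec G.exists_isCanonicalMeasure

lemma voltageIntegral_canonicalMeasure_self (x : G.Point) :
    G.voltageIntegral G.canonicalMeasure x x = 2 * G.tau := by
  obtain ⟨-, c, hc⟩ := G.isCanonicalMeasure_canonicalMeasure
  rw [tau, hc, hc]
  ring

lemma voltageIntegral_canonicalMeasure (x y : G.Point) :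
    G.voltageIntegral G.canonicalMeasure x y = 2 * G.tau - 1 / 2 * G.resistance x y := by
  have h := G.two_mul_voltageIntegral G.isCanonicalMeasure_canonicalMeasure.1 x y
  rw [voltageIntegral_canonicalMeasure_self, voltageIntegral_canonicalMeasure_self] at h
  linarith

lemma integral_resistance_canonicalMeasure (y : G.Point) :
    (∫ᵛ x, G.resistance x y ∂•G.canonicalMeasure) = 2 * G.tau := by
  simp only [G.resistance_comm _ y]
  exact G.voltageIntegral_canonicalMeasure_self y

lemma integral_voltageIntegral_canonicalMeasure (y : G.Point) :
    (∫ᵛ x, G.voltageIntegral G.canonicalMeasure x y ∂•G.canonicalMeasure) = G.tau := by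
  have hcont := (G.continuous_resistance_left y).const_mul (1 / 2)
  simp only [voltageIntegral_canonicalMeasure]
  rw [VectorMeasure.integral_fun_sub (integrable_of_continuous _ continuous_const)
    (integrable_of_continuous _ hcont), integral_const_signedMeasure,
    G.isCanonicalMeasure_canonicalMeasure.1]
  have hmul := VectorMeasure.integral_fun_smul G.canonicalMeasure
    (ContinuousLinearMap.lsmul ℝ ℝ) (1 / 2) fun x => G.resistance x y
  simp only [smul_eq_mul] at hmul
  rw [hmul, integral_resistance_canonicalMeasure]
  ring

lemma greenCan_eq (x y : G.Point) : G.greenCan x y = G.tau - 1 / 2 * G.resistance x y := by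
  have hmean : (∫ᵛ y, (∫ᵛ x, G.voltageIntegral G.canonicalMeasure x y ∂•G.canonicalMeasure)
      ∂•G.canonicalMeasure) = G.tau := by
    simp only [integral_voltageIntegral_canonicalMeasure]
    rw [integral_const_signedMeasure, G.isCanonicalMeasure_canonicalMeasure.1, mul_one]
  refine (congrArg₂ (· - ·) (G.voltageIntegral_canonicalMeasure x y) hmean).trans ?_
  ring

end green

variable {G}

/-! ### The two sides of a bridge -/

variable (G) in
lemma vertex_mem_deleteEdge (i : E) (v : V) : G.vertex v ∈ G.deleteEdge i :=
  G.mem_deleteEdge_iff_coord.2 (G.coord_vertex i v)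

lemma point_mem_deleteEdge {i e : E} (h : e ≠ i) (t : ℝ) : G.point e t ∈ G.deleteEdge i :=
  G.mem_deleteEdge_iff_coord.2 (G.coord_point_of_ne h t)

lemma joinedIn_point {F : Set G.Point} {e : E} {s t : ℝ} (h : ∀ u ∈ uIcc s t, G.point e u ∈ F) :
    JoinedIn F (G.point e s) (G.point e t) := by
  have himage : IsPathConnected (G.point e '' uIcc s t) :=
    ((convex_uIcc s t).isPathConnected nonempty_uIcc).image (G.continuous_point e)
  exact (himage.joinedIn _ (mem_image_of_mem _ left_mem_uIcc) _
    (mem_image_of_mem _ right_mem_uIcc)).mono (image_subset_iff.2 h)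

lemma joinedIn_deleteEdge_point {i e : E} (h : e ≠ i) (s t : ℝ) :
    JoinedIn (G.deleteEdge i) (G.point e s) (G.point e t) :=
  joinedIn_point fun u _ => point_mem_deleteEdge h u

lemma joinedIn_deleteEdge_p_q {i e : E} (h : e ≠ i) :
    JoinedIn (G.deleteEdge i) (G.p e) (G.q e) := by
  simpa only [point_zero, point_len] using joinedIn_deleteEdge_point (G := G) h 0 (G.len e)

lemma exists_joinedIn_vertex {i : E} {y : G.Point} (hy : y ∈ G.deleteEdge i) :
    ∃ v, JoinedIn (G.deleteEdge i) (G.vertex v) y := by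
  obtain ⟨v, rfl⟩ | ⟨e, t, ht, rfl⟩ := G.exists_vertex_or_point y
  · exact ⟨v, JoinedIn.refl hy⟩
  · have he : e ≠ i := by
      rintro rfl
      exact hy (mem_image_of_mem _ ht)
    refine ⟨G.src e, ?_⟩
    rw [← p, ← point_zero]
    exact joinedIn_deleteEdge_point he 0 t

lemma joinedIn_p_or_q {i : E} {y : G.Point} (hy : y ∈ G.deleteEdge i) :
    JoinedIn (G.deleteEdge i) (G.p i) y ∨ JoinedIn (G.deleteEdge i) (G.q i) y := by
  have hrefl (v : V) := JoinedIn.refl (G.vertex_mem_deleteEdge i v)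
  have hvertex (v : V) : JoinedIn (G.deleteEdge i) (G.p i) (G.vertex v) ∨
      JoinedIn (G.deleteEdge i) (G.q i) (G.vertex v) := by
    refine (G.eq_of_forall_edge (u := fun v => JoinedIn (G.deleteEdge i) (G.p i) (G.vertex v) ∨
      JoinedIn (G.deleteEdge i) (G.q i) (G.vertex v)) (fun e => propext ?_) v (G.src i)).mpr
        (Or.inl (hrefl _))
    obtain rfl | he := eq_or_ne e i
    · exact iff_of_true (Or.inl (hrefl _)) (Or.inr (hrefl _))
    · have hedge := joinedIn_deleteEdge_p_q (G := G) he
      exact or_congr ⟨(·.trans hedge), (·.trans hedge.symm)⟩ ⟨(·.trans hedge), (·.trans hedge.symm)⟩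
  obtain ⟨v, hv⟩ := exists_joinedIn_vertex hy
  exact (hvertex v).imp (·.trans hv) (·.trans hv)

lemma onSide_of_joinedIn {i : E} {a y : G.Point} (h : JoinedIn (G.deleteEdge i) a y) :
    G.OnSide i a y := by
  obtain ⟨γ, hγ⟩ := h
  exact (isPreconnected_range γ.continuous).subset_connectedComponentIn ⟨0, γ.source⟩
    (range_subset_iff.2 hγ) ⟨1, γ.target⟩

lemma onSide_p_or_q {i : E} {y : G.Point} (hy : y ∈ G.deleteEdge i) :
    G.OnSide i (G.p i) y ∨ G.OnSide i (G.q i) y :=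
  (joinedIn_p_or_q hy).imp onSide_of_joinedIn onSide_of_joinedIn

variable (G) in
/-- The set of the vertices of the component of `Γ - i` that contains `p i`. -/
def side (i : E) : Set V := {v | JoinedIn (G.deleteEdge i) (G.p i) (G.vertex v)}

lemma src_mem_side (i : E) : G.src i ∈ G.side i :=
  JoinedIn.refl (G.vertex_mem_deleteEdge i _)

lemma IsBridge.tgt_notMem_side {i : E} (hi : G.IsBridge i) : G.tgt i ∉ G.side i := fun h =>
  hi <| IsPathConnected.isConnected ⟨G.p i, G.vertex_mem_deleteEdge i _,
    fun {_} hy => (joinedIn_p_or_q hy).elim id (JoinedIn.trans h)⟩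

lemma src_mem_side_iff {i e : E} (h : e ≠ i) : G.src e ∈ G.side i ↔ G.tgt e ∈ G.side i :=
  ⟨fun hsrc => JoinedIn.trans hsrc (joinedIn_deleteEdge_p_q h),
    fun htgt => JoinedIn.trans htgt (joinedIn_deleteEdge_p_q h).symm⟩

variable (G) in
/-- The indicator function of the side of `p i`, extended affinely to the edge `i`. It is continuous
and tells the sides of a bridge `i` apart. -/
def cut (i : E) : G.Point → ℝ := G.interpolate ((G.side i).indicator 1)

lemma cut_p (i : E) : G.cut i (G.p i) = 1 := indicator_of_mem (src_mem_side i) 1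

lemma IsBridge.cut_q {i : E} (hi : G.IsBridge i) : G.cut i (G.q i) = 0 :=
  indicator_of_notMem hi.tgt_notMem_side 1

lemma IsBridge.cut_point {i : E} (hi : G.IsBridge i) {t : ℝ} (ht : t ∈ Icc 0 (G.len i)) :
    G.cut i (G.point i t) = 1 - t / G.len i := by
  rw [cut, G.interpolate_point _ ht, indicator_of_mem (src_mem_side i),
    indicator_of_notMem hi.tgt_notMem_side, smul_zero, add_zero, Pi.one_apply, smul_eq_mul, mul_one]

lemma IsBridge.cut_point_injOn {i : E} (hi : G.IsBridge i) :
    InjOn (fun t => G.cut i (G.point i t)) (Icc 0 (G.len i)) := fun s hs t ht h => by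
  simpa only [hi.cut_point hs, hi.cut_point ht, sub_right_inj,
    div_left_inj' (G.len_pos i).ne'] using h

lemma cut_point_of_ne {i e : E} (h : e ≠ i) {t : ℝ} (ht : t ∈ Icc 0 (G.len e)) :
    G.cut i (G.point e t) = (G.side i).indicator 1 (G.src e) := by
  have hends : (G.side i).indicator (1 : V → ℝ) (G.tgt e) =
      (G.side i).indicator 1 (G.src e) := by
    classical simp only [indicator_apply, src_mem_side_iff h, Pi.one_apply]
  rw [cut, G.interpolate_point _ ht, hends, ← add_smul, sub_add_cancel, one_smul]

lemma cut_mem_of_mem_deleteEdge {i : E} {a : G.Point} (ha : a ∈ G.deleteEdge i) :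
    G.cut i a ∈ ({0, 1} : Set ℝ) := by
  have hind (v : V) : (G.side i).indicator (1 : V → ℝ) v ∈ ({0, 1} : Set ℝ) :=
    indicator_eq_zero_or_self _ _ v
  obtain ⟨v, rfl⟩ | ⟨e, t, ht, rfl⟩ := G.exists_vertex_or_point a
  · exact hind v
  · have he : e ≠ i := by
      rintro rfl
      exact ha (mem_image_of_mem _ ht)
    rw [cut_point_of_ne he (Ioo_subset_Icc_self ht)]
    exact hind _

lemma cut_eq_of_isPreconnected {i : E} {C : Set G.Point} (hC : IsPreconnected C)
    (hsub : C ⊆ G.deleteEdge i) {a b : G.Point} (ha : a ∈ C) (hb : b ∈ C) :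
    G.cut i a = G.cut i b :=
  hC.constant_of_mapsTo (toFinite {0, 1}).isDiscrete (G.continuous_interpolate _).continuousOn
    (fun _ hx => cut_mem_of_mem_deleteEdge (hsub hx)) ha hb

lemma OnSide.cut_eq {i : E} {a y : G.Point} (h : G.OnSide i a y) : G.cut i y = G.cut i a :=
  cut_eq_of_isPreconnected isPreconnected_connectedComponentIn (connectedComponentIn_subset _ _) h
    (mem_connectedComponentIn (connectedComponentIn_nonempty_iff.1 ⟨y, h⟩))

lemma cut_eq_p_or_q {i : E} {y : G.Point} (hy : y ∈ G.deleteEdge i) :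
    G.cut i y = G.cut i (G.p i) ∨ G.cut i y = G.cut i (G.q i) :=
  (onSide_p_or_q hy).imp OnSide.cut_eq OnSide.cut_eq

/-! ### Betweenness -/

lemma Between.symm {a x y : G.Point} (h : G.Between a x y) : G.Between a y x := fun γ => by
  simpa only [Path.symm_range] using h γ.symm

instance : T1Space G.Point where
  t1 a := G.isClosed_of_point fun e => by
    have hfinite : ({0, G.len e, G.coord e a} : Set ℝ).Finite := toFinite _
    refine (hfinite.subset ?_).isClosed
    rintro t ⟨ht, rfl⟩
    obtain rfl | h0 := ht.1.eq_or_lt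
    · exact Or.inl rfl
    obtain rfl | h1 := ht.2.eq_or_lt
    · exact Or.inr (Or.inl rfl)
    · exact Or.inr (Or.inr ((G.point_eq_iff_coord ⟨h0, h1⟩ _).1 rfl).symm)

lemma IsBridge.isClosed_cut_ne_union_singleton {i : E} (hi : G.IsBridge i) {r : ℝ}
    (hr : r ∈ Icc 0 (G.len i)) :
    IsClosed ({x | G.cut i x ≠ G.cut i (G.point i r)} ∪ {G.point i r}) := by
  refine G.isClosed_of_point fun e => ?_
  obtain rfl | he := eq_or_ne e i
  · rw [inter_eq_left.2]
    · exact isClosed_Icc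
    intro t ht
    obtain rfl | htr := eq_or_ne t r
    · exact Or.inr rfl
    · exact Or.inl fun h => htr (hi.cut_point_injOn ht hr h)
  · by_cases hside : (G.side i).indicator 1 (G.src e) = G.cut i (G.point i r)
    · suffices h : Icc 0 (G.len e) ∩ G.point e ⁻¹' ({x | G.cut i x ≠ G.cut i (G.point i r)} ∪
          {G.point i r}) = Icc 0 (G.len e) ∩ G.point e ⁻¹' {G.point i r} by
        rw [h]
        exact isClosed_Icc.inter (isClosed_singleton.preimage (G.continuous_point e))
      ext t
      refine and_congr_right fun ht => or_iff_right fun h => h ?_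
      rw [cut_point_of_ne he ht, hside]
    · rw [inter_eq_left.2]
      · exact isClosed_Icc
      intro t ht
      refine Or.inl fun h => hside ?_
      rw [← h, cut_point_of_ne he ht]

lemma IsBridge.between_of_cut_eq {i : E} (hi : G.IsBridge i) {r s : ℝ} (hr : r ∈ Icc 0 (G.len i))
    (hs : s ∈ Icc 0 (G.len i)) {y : G.Point} (hy : G.cut i y = G.cut i (G.point i r)) :
    G.Between (G.point i r) (G.point i s) y := by
  intro γ
  have hcover : ∀ x, x ∈ {x | G.cut i x = G.cut i (G.point i r)} ∪
      ({x | G.cut i x ≠ G.cut i (G.point i r)} ∪ {G.point i r}) := fun x => by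
    rw [← union_assoc]
    exact Or.inl (em _)
  have hstart : G.point i s ∈ {x | G.cut i x ≠ G.cut i (G.point i r)} ∪ {G.point i r} := by
    by_cases h : G.cut i (G.point i s) = G.cut i (G.point i r)
    · exact Or.inr (congrArg (G.point i) (hi.cut_point_injOn hs hr h))
    · exact Or.inl h
  obtain ⟨x, hx, hxcut, hne | rfl⟩ := isPreconnected_closed_iff.1
    (isPreconnected_range γ.continuous) _ _
    (isClosed_eq (G.continuous_interpolate _) continuous_const)
    (hi.isClosed_cut_ne_union_singleton hr) (fun x _ => hcover x) ⟨y, ⟨1, γ.target⟩, hy⟩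
    ⟨_, ⟨0, γ.source⟩, hstart⟩
  · exact absurd hxcut hne
  · exact hx

lemma joinedIn_cut_eq {i : E} {a b : G.Point} (h : JoinedIn (G.deleteEdge i) a b) :
    JoinedIn {x | G.cut i x = G.cut i b} a b := by
  obtain ⟨γ, hγ⟩ := h
  exact ⟨γ, fun t => cut_eq_of_isPreconnected (isPreconnected_range γ.continuous)
    (range_subset_iff.2 hγ) (mem_range_self t) ⟨1, γ.target⟩⟩

lemma exists_joinedIn_of_cut_ne {i : E} {y : G.Point} (hy : y ∈ G.deleteEdge i) {r s : ℝ}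
    (hr : r = 0 ∨ r = G.len i) (hs : s ∈ Icc 0 (G.len i)) (hrs : r ≠ s)
    (hcut : G.cut i y ≠ G.cut i (G.point i r)) :
    ∃ t ∈ Icc 0 (G.len i), JoinedIn (G.deleteEdge i) (G.point i t) y ∧ r ∉ uIcc s t := by
  obtain hp | hq := joinedIn_p_or_q hy
  · obtain rfl | rfl := hr
    · exact absurd (onSide_of_joinedIn hp).cut_eq (by rwa [← point_zero])
    · refine ⟨0, G.zero_mem_Icc i, by rwa [point_zero], ?_⟩
      rw [uIcc_of_ge hs.1]
      exact fun h => hrs (le_antisymm h.2 hs.2)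
  · obtain rfl | rfl := hr
    · refine ⟨G.len i, G.len_mem_Icc i, by rwa [point_len], ?_⟩
      rw [uIcc_of_le hs.2]
      exact fun h => hrs (le_antisymm hs.1 h.1)
    · exact absurd (onSide_of_joinedIn hq).cut_eq (by rwa [← point_len])

lemma IsBridge.cut_eq_of_between {i : E} (hi : G.IsBridge i) {y : G.Point}
    (hy : y ∈ G.deleteEdge i) {r s : ℝ} (hr : r = 0 ∨ r = G.len i) (hs : s ∈ Icc 0 (G.len i))
    (hrs : r ≠ s) (h : G.Between (G.point i r) (G.point i s) y) :
    G.cut i y = G.cut i (G.point i r) := by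
  by_contra hne
  obtain ⟨r', hr', hjoined, hseg⟩ := exists_joinedIn_of_cut_ne hy hr hs hrs hne
  have hleave : JoinedIn {x | G.cut i x ≠ G.cut i (G.point i r)} (G.point i s) (G.point i r') :=
    joinedIn_point fun t ht htr => hseg <|
      hi.cut_point_injOn (uIcc_subset_Icc hs hr' ht) (G.mem_Icc_of_eq_zero_or_len hr) htr ▸ ht
  have harrive : JoinedIn {x | G.cut i x ≠ G.cut i (G.point i r)} (G.point i r') y :=
    (joinedIn_cut_eq hjoined).mono fun _ hx => hx.trans_ne hne
  obtain ⟨γ, hγ⟩ := hleave.trans harrive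
  obtain ⟨t, ht⟩ := h γ
  exact hγ t (congrArg (G.cut i) ht)

/-! ### Resistance across a bridge -/

section bridgeResistance

variable [Fintype E]

lemma IsBridge.laplacian_side {i : E} (hi : G.IsBridge i) :
    G.laplacian ((G.side i).indicator 1) = (G.len i)⁻¹ • G.incidence i := by
  rw [laplacian_apply, Finset.sum_eq_single i _ (absurd (Finset.mem_univ i)),
    indicator_of_mem (src_mem_side i), indicator_of_notMem hi.tgt_notMem_side, Pi.one_apply,
    sub_zero, one_div]
  intro e _ he
  classical simp only [indicator_apply, src_mem_side_iff he, Pi.one_apply, sub_self, zero_div,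
    zero_smul]

lemma IsBridge.exists_kernel_p_sub_kernel_q [Fintype V] {i : E} (hi : G.IsBridge i) :
    ∃ c, ∀ y, G.kernel (G.p i) y - G.kernel (G.q i) y = G.len i * (G.cut i y - c) := by
  set u : V → ℝ := (G.side i).indicator 1
  have hpot : G.potential (G.incidence i) =
      G.len i • (u - fun _ => (∑ w, u w) / Fintype.card V) := by
    have hinc : G.incidence i = G.len i • G.laplacian u := by
      rw [hi.laplacian_side, smul_inv_smul₀ (G.len_pos i).ne']
    rw [hinc, map_smul]
    congr 1
    exact funext (G.potential_laplacian u)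
  refine ⟨(∑ w, u w) / Fintype.card V, fun y => ?_⟩
  rw [p, q, kernel_vertex, kernel_vertex, ← dotProduct_incidence, dotProduct_comm,
    dotProduct_potential_comm, hpot, dotProduct_smul, dotProduct_sub, weight_dotProduct,
    weight_dotProduct, interpolate_const, smul_eq_mul, cut]

variable [Finite V]

lemma IsBridge.resistance_point_left {i : E} (hi : G.IsBridge i) {s : ℝ}
    (hs : s ∈ Icc 0 (G.len i)) (y : G.Point) :
    G.resistance (G.point i s) y =
      G.resistance (G.p i) y + (2 * G.cut i y - 1) * s - 2 * G.hat i s (G.coord i y) := by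
  have := Fintype.ofFinite V
  obtain ⟨c, hc⟩ := hi.exists_kernel_p_sub_kernel_q
  have hkernel (y : G.Point) : G.kernel (G.point i s) y =
      G.kernel (G.p i) y - s * (G.cut i y - c) + G.hat i s (G.coord i y) := by
    have hq : G.kernel (G.q i) y = G.kernel (G.p i) y - G.len i * (G.cut i y - c) := by
      rw [← hc, sub_sub_cancel]
    rw [G.kernel_point hs, hq]
    field_simp [(G.len_pos i).ne']
    ring
  have hself : G.kernel (G.point i s) (G.point i s) =
      G.kernel (G.p i) (G.p i) - s * (1 - 2 * c) := by
    rw [hkernel, G.kernel_comm (G.p i), hkernel, hi.cut_point hs, cut_p, p,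
      hat_comm, G.hat_coord_vertex i _ hs.1, hat_comm, G.hat_coord_point hs hs, hat, min_self]
    ring
  rw [resistance_eq, resistance_eq, hself, hkernel]
  ring

lemma IsBridge.resistance_point_point {i : E} (hi : G.IsBridge i) {s t : ℝ}
    (hs : s ∈ Icc 0 (G.len i)) (ht : t ∈ Icc 0 (G.len i)) :
    G.resistance (G.point i s) (G.point i t) = |s - t| := by
  have hp : G.resistance (G.p i) (G.point i t) = t := by
    have := Fintype.ofFinite V
    rw [resistance_comm, hi.resistance_point_left ht, cut_p, p, hat_comm,
      G.hat_coord_vertex i _ ht.1, resistance_eq]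
    ring
  have hmin : min s t = (s + t - |s - t|) / 2 := by
    rw [abs_sub_comm, ← max_sub_min_eq_abs, ← min_add_max s t]
    ring
  rw [hi.resistance_point_left hs, hi.cut_point ht, hp, hat_comm, G.hat_coord_point ht hs, hat,
    min_comm, hmin]
  ring

lemma IsBridge.resistance_add_of_cut_eq {i : E} (hi : G.IsBridge i) {r s : ℝ}
    (hr : r ∈ Icc 0 (G.len i)) (hs : s ∈ Icc 0 (G.len i)) {y : G.Point} (hy : y ∈ G.deleteEdge i)
    (hcut : G.cut i y = G.cut i (G.point i r)) :
    G.resistance (G.point i s) y = |s - r| + G.resistance (G.point i r) y := by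
  have hhat (u : ℝ) (hu : u ∈ Icc 0 (G.len i)) : G.hat i u (G.coord i y) = 0 := by
    rw [G.mem_deleteEdge_iff_coord.1 hy, hat_comm, G.hat_zero_left i hu.1]
  have hdist : (2 * G.cut i y - 1) * (s - r) = |s - r| := by
    have hcutr := hi.cut_point hr
    obtain h | h := cut_mem_of_mem_deleteEdge hy
    · obtain rfl : r = G.len i := hi.cut_point_injOn hr (G.len_mem_Icc i) <| by
        simp only [← hcut, h, point_len, hi.cut_q]
      rw [h, abs_of_nonpos (sub_nonpos.2 hs.2)]
      ring
    · obtain rfl : r = 0 := hi.cut_point_injOn hr (G.zero_mem_Icc i) <| by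
        simp only [← hcut, mem_singleton_iff.1 h, point_zero, cut_p]
      rw [h, abs_of_nonneg (sub_nonneg.2 hs.1)]
      ring
  rw [hi.resistance_point_left hs, hi.resistance_point_left hr, hhat s hs, hhat r hr, ← hdist]
  ring

lemma IsBridge.resistance_add_of_between {i : E} (hi : G.IsBridge i) {r s : ℝ}
    (hr : r = 0 ∨ r = G.len i) (hs : s ∈ Icc 0 (G.len i)) {y : G.Point} (hy : y ∈ G.deleteEdge i)
    (h : G.Between (G.point i r) (G.point i s) y) :
    G.resistance (G.point i s) y = |s - r| + G.resistance (G.point i r) y := by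
  obtain rfl | hrs := eq_or_ne r s
  · rw [sub_self, abs_zero, zero_add]
  · exact hi.resistance_add_of_cut_eq (G.mem_Icc_of_eq_zero_or_len hr) hs hy
      (hi.cut_eq_of_between hy hr hs hrs h)

end bridgeResistance

/-! ### The Arakelov-Green function on bridges -/

lemma IsBridge.p_or_q_between {i : E} (hi : G.IsBridge i) {s : ℝ} (hs : s ∈ Icc 0 (G.len i))
    {y : G.Point} (hy : y ∈ G.deleteEdge i) :
    G.Between (G.p i) (G.point i s) y ∨ G.Between (G.q i) (G.point i s) y := by
  simp only [← point_zero, ← point_len]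
  refine (cut_eq_p_or_q hy).imp (fun h => hi.between_of_cut_eq (G.zero_mem_Icc i) hs ?_)
    fun h => hi.between_of_cut_eq (G.len_mem_Icc i) hs ?_
  · rwa [point_zero]
  · rwa [point_len]

section greenCan

variable [Finite V] [Fintype E]

lemma IsBridge.resistance_of_between_of_between {i j : E} (hi : G.IsBridge i) (hj : G.IsBridge j)
    (hij : i ≠ j) {a b s t : ℝ} (hs : s ∈ Icc 0 (G.len i)) (ht : t ∈ Icc 0 (G.len j))
    (ha : a = 0 ∨ a = G.len i) (hb : b = 0 ∨ b = G.len j)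
    (hbet_a : G.Between (G.point i a) (G.point i s) (G.point j t))
    (hbet_b : G.Between (G.point j b) (G.point i s) (G.point j t)) :
    G.resistance (G.point i s) (G.point j t) =
      |s - a| + |t - b| + G.resistance (G.point i a) (G.point j b) := by
  have hsrc : G.resistance (G.point j t) (G.point i a) =
      |t - b| + G.resistance (G.point j b) (G.point i a) := by
    obtain rfl | hbt := eq_or_ne b t
    · rw [sub_self, abs_zero, zero_add]
    refine hj.resistance_add_of_cut_eq (G.mem_Icc_of_eq_zero_or_len hb) ht
      (point_mem_deleteEdge hij a) ?_
    rw [← hj.cut_eq_of_between (point_mem_deleteEdge hij s) hb ht hbt hbet_b.symm,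
      cut_point_of_ne hij (G.mem_Icc_of_eq_zero_or_len ha), cut_point_of_ne hij hs]
  rw [hi.resistance_add_of_between ha hs (point_mem_deleteEdge hij.symm t) hbet_a,
    G.resistance_comm (G.point i a), hsrc, G.resistance_comm (G.point j b), add_assoc]

variable [Nonempty V]

variable (G) in
lemma greenCan_comm (x y : G.Point) : G.greenCan x y = G.greenCan y x := by
  rw [greenCan_eq, greenCan_eq, resistance_comm]

lemma IsBridge.greenCan_of_between_of_between {i j : E} (hi : G.IsBridge i) (hj : G.IsBridge j)
    (hij : i ≠ j) {a b s t : ℝ} (hs : s ∈ Icc 0 (G.len i)) (ht : t ∈ Icc 0 (G.len j))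
    (ha : a = 0 ∨ a = G.len i) (hb : b = 0 ∨ b = G.len j)
    (hbet_a : G.Between (G.point i a) (G.point i s) (G.point j t))
    (hbet_b : G.Between (G.point j b) (G.point i s) (G.point j t)) :
    G.greenCan (G.point i s) (G.point j t) =
      G.tau - (1 / 2) * (|s - a| + |t - b| + G.resistance (G.point i a) (G.point j b)) := by
  rw [greenCan_eq, hi.resistance_of_between_of_between hj hij hs ht ha hb hbet_a hbet_b]

lemma IsBridge.greenCan_of_onSide {i j : E} (hi : G.IsBridge i) (hij : i ≠ j) {a s t : ℝ}
    (ha : a ∈ Icc 0 (G.len i)) (hs : s ∈ Icc 0 (G.len i)) (ht : t ∈ Icc 0 (G.len j))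
    (h : G.OnSide i (G.point i a) (G.point j t)) :
    G.greenCan (G.point i s) (G.point j t) =
      G.tau + t ^ 2 * ((G.len j - G.resistance (G.p j) (G.q j)) / (2 * G.len j ^ 2))
        - t * ((G.len j - G.resistance (G.p j) (G.q j) + G.resistance (G.point i a) (G.q j)
            - G.resistance (G.point i a) (G.p j)) / (2 * G.len j))
        - (1 / 2) * (|s - a| + G.resistance (G.point i a) (G.p j)) := by
  rw [greenCan_eq, hi.resistance_add_of_cut_eq ha hs (point_mem_deleteEdge hij.symm t) h.cut_eq,
    G.resistance_point_of_mem_deleteEdge (point_mem_deleteEdge hij a) ht]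
  field_simp [(G.len_pos j).ne']
  ring

lemma IsBridge.greenCan_of_onSide_p {i j : E} (hi : G.IsBridge i) (hij : i ≠ j) {s t : ℝ}
    (hs : s ∈ Icc 0 (G.len i)) (ht : t ∈ Icc 0 (G.len j)) (h : G.OnSide i (G.p i) (G.point j t)) :
    G.greenCan (G.point i s) (G.point j t) =
      G.tau + t ^ 2 * ((G.len j - G.resistance (G.p j) (G.q j)) / (2 * G.len j ^ 2))
        - t * ((G.len j - G.resistance (G.p j) (G.q j) + G.resistance (G.p i) (G.q j)
            - G.resistance (G.p i) (G.p j)) / (2 * G.len j))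
        - (1 / 2) * (s + G.resistance (G.p i) (G.p j)) := by
  rw [← point_zero] at h
  rw [hi.greenCan_of_onSide hij (G.zero_mem_Icc i) hs ht h, point_zero, sub_zero,
    abs_of_nonneg hs.1]

lemma IsBridge.greenCan_of_onSide_q {i j : E} (hi : G.IsBridge i) (hij : i ≠ j) {s t : ℝ}
    (hs : s ∈ Icc 0 (G.len i)) (ht : t ∈ Icc 0 (G.len j)) (h : G.OnSide i (G.q i) (G.point j t)) :
    G.greenCan (G.point i s) (G.point j t) =
      G.tau + t ^ 2 * ((G.len j - G.resistance (G.p j) (G.q j)) / (2 * G.len j ^ 2))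
        - t * ((G.len j - G.resistance (G.p j) (G.q j) + G.resistance (G.q i) (G.q j)
            - G.resistance (G.q i) (G.p j)) / (2 * G.len j))
        - (1 / 2) * (G.len i - s + G.resistance (G.q i) (G.p j)) := by
  rw [← point_len] at h
  rw [hi.greenCan_of_onSide hij (G.len_mem_Icc i) hs ht h, point_len, abs_sub_comm,
    abs_of_nonneg (sub_nonneg.2 hs.2)]

end greenCan

end

end MetrizedGraph

theorem theorem4p4 {V E : Type*} [Finite V] [Nonempty V] [Fintype E] (G : MetrizedGraph V E)
    (i j : E) (x y : ℝ) (hx : x ∈ Set.Icc 0 (G.len i)) (hy : y ∈ Set.Icc 0 (G.len j)) :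
    -- `x` and `y` are on the same bridge
    (i = j → G.IsBridge i →
      G.greenCan (G.point i x) (G.point j y) = G.tau - (1 / 2) * |x - y|) ∧
    -- `e_i` and `e_j` are distinct bridges: four cases, one of which always occurs
    (i ≠ j → G.IsBridge i → G.IsBridge j →
      ((G.Between (G.p i) (G.point i x) (G.point j y) ∧
            G.Between (G.p j) (G.point i x) (G.point j y)) ∨
        (G.Between (G.p i) (G.point i x) (G.point j y) ∧
            G.Between (G.q j) (G.point i x) (G.point j y)) ∨
        (G.Between (G.p j) (G.point i x) (G.point j y) ∧
            G.Between (G.q i) (G.point i x) (G.point j y)) ∨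
        (G.Between (G.q i) (G.point i x) (G.point j y) ∧
            G.Between (G.q j) (G.point i x) (G.point j y))) ∧
      (G.Between (G.p i) (G.point i x) (G.point j y) →
        G.Between (G.p j) (G.point i x) (G.point j y) →
        G.greenCan (G.point i x) (G.point j y) =
          G.tau - (1 / 2) * (x + y + G.resistance (G.p i) (G.p j))) ∧
      (G.Between (G.p i) (G.point i x) (G.point j y) →
        G.Between (G.q j) (G.point i x) (G.point j y) →
        G.greenCan (G.point i x) (G.point j y) =
          G.tau - (1 / 2) * (x + G.len j - y + G.resistance (G.p i) (G.q j))) ∧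
      (G.Between (G.p j) (G.point i x) (G.point j y) →
        G.Between (G.q i) (G.point i x) (G.point j y) →
        G.greenCan (G.point i x) (G.point j y) =
          G.tau - (1 / 2) * (G.len i - x + y + G.resistance (G.p j) (G.q i))) ∧
      (G.Between (G.q i) (G.point i x) (G.point j y) →
        G.Between (G.q j) (G.point i x) (G.point j y) →
        G.greenCan (G.point i x) (G.point j y) =
          G.tau - (1 / 2) * (G.len i - x + G.len j - y + G.resistance (G.q i) (G.q j)))) ∧
    -- only `e_i` is a bridge: two cases, one of which always occurs
    (G.IsBridge i → ¬ G.IsBridge j →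
      (G.OnSide i (G.p i) (G.point j y) ∨ G.OnSide i (G.q i) (G.point j y)) ∧
      (G.OnSide i (G.p i) (G.point j y) →
        G.greenCan (G.point i x) (G.point j y) =
          G.tau + y ^ 2 * ((G.len j - G.resistance (G.p j) (G.q j)) / (2 * G.len j ^ 2))
            - y * ((G.len j - G.resistance (G.p j) (G.q j) + G.resistance (G.p i) (G.q j)
                - G.resistance (G.p i) (G.p j)) / (2 * G.len j))
            - (1 / 2) * (x + G.resistance (G.p i) (G.p j))) ∧
      (G.OnSide i (G.q i) (G.point j y) →
        G.greenCan (G.point i x) (G.point j y) =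
          G.tau + y ^ 2 * ((G.len j - G.resistance (G.p j) (G.q j)) / (2 * G.len j ^ 2))
            - y * ((G.len j - G.resistance (G.p j) (G.q j) + G.resistance (G.q i) (G.q j)
                - G.resistance (G.q i) (G.p j)) / (2 * G.len j))
            - (1 / 2) * (G.len i - x + G.resistance (G.q i) (G.p j)))) ∧
    -- only `e_j` is a bridge: the same with the roles of `(e_i, x)` and `(e_j, y)` exchanged
    (¬ G.IsBridge i → G.IsBridge j →
      (G.OnSide j (G.p j) (G.point i x) ∨ G.OnSide j (G.q j) (G.point i x)) ∧
      (G.OnSide j (G.p j) (G.point i x) →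
        G.greenCan (G.point i x) (G.point j y) =
          G.tau + x ^ 2 * ((G.len i - G.resistance (G.p i) (G.q i)) / (2 * G.len i ^ 2))
            - x * ((G.len i - G.resistance (G.p i) (G.q i) + G.resistance (G.p j) (G.q i)
                - G.resistance (G.p j) (G.p i)) / (2 * G.len i))
            - (1 / 2) * (y + G.resistance (G.p j) (G.p i))) ∧
      (G.OnSide j (G.q j) (G.point i x) →
        G.greenCan (G.point i x) (G.point j y) =
          G.tau + x ^ 2 * ((G.len i - G.resistance (G.p i) (G.q i)) / (2 * G.len i ^ 2))
            - x * ((G.len i - G.resistance (G.p i) (G.q i) + G.resistance (G.q j) (G.q i)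
                - G.resistance (G.q j) (G.p i)) / (2 * G.len i))
            - (1 / 2) * (G.len j - y + G.resistance (G.q j) (G.p i)))) := by
  have hx₀ : |x - 0| = x := by rw [sub_zero, abs_of_nonneg hx.1]
  have hy₀ : |y - 0| = y := by rw [sub_zero, abs_of_nonneg hy.1]
  have hxL : |x - G.len i| = G.len i - x := by rw [abs_sub_comm, abs_of_nonneg (sub_nonneg.2 hx.2)]
  have hyL : |y - G.len j| = G.len j - y := by rw [abs_sub_comm, abs_of_nonneg (sub_nonneg.2 hy.2)]
  refine ⟨?_, fun hij hi hj => ?_, fun hi hj => ?_, fun hi hj => ?_⟩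
  · rintro rfl hi
    rw [G.greenCan_eq, hi.resistance_point_point hx hy]
  · have hi_between := hi.p_or_q_between hx (MetrizedGraph.point_mem_deleteEdge hij.symm y)
    have hj_between := (hj.p_or_q_between hy (MetrizedGraph.point_mem_deleteEdge hij x)).imp
      MetrizedGraph.Between.symm MetrizedGraph.Between.symm
    refine ⟨by tauto, ?_⟩
    have hgreen {a b : ℝ} := hi.greenCan_of_between_of_between (a := a) (b := b) hj hij hx hy
    simp only [← G.point_zero, ← G.point_len]
    refine ⟨fun h h' => ?_, fun h h' => ?_, fun h h' => ?_, fun h h' => ?_⟩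
    · rw [hgreen (.inl rfl) (.inl rfl) h h', hx₀, hy₀]
    · rw [hgreen (.inl rfl) (.inr rfl) h h', hx₀, hyL, add_sub_assoc]
    · rw [hgreen (.inr rfl) (.inl rfl) h' h, hxL, hy₀, G.resistance_comm (G.point j 0)]
    · rw [hgreen (.inr rfl) (.inr rfl) h h', hxL, hyL, add_sub_assoc]
  · have hij : i ≠ j := fun h => hj (h ▸ hi)
    exact ⟨MetrizedGraph.onSide_p_or_q (MetrizedGraph.point_mem_deleteEdge hij.symm y),
      hi.greenCan_of_onSide_p hij hx hy, hi.greenCan_of_onSide_q hij hx hy⟩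
  · have hji : j ≠ i := fun h => hi (h ▸ hj)
    rw [G.greenCan_comm]
    exact ⟨MetrizedGraph.onSide_p_or_q (MetrizedGraph.point_mem_deleteEdge hji.symm x),
      hj.greenCan_of_onSide_p hji hy hx, hj.greenCan_of_onSide_q hji hy hx⟩
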